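/- **Strict FFR edge coverage in closed form (no noise, $\alpha=4$).** Base stations form a homogeneous Poisson point process $\{z_n\}$ of density $\lambda>0$ in $\mathbb R^2$; the user is at the origin and is served by the closest base station, with index $y$, at distance $r=\|z_y\|$. All base stations transmit with power $P>0$. The fadings $g_n$ (common sub-band) and $\hat g_n$ (reserved sub-bands) are exponential with mean $\mu>0$, the reserved sub-band $\delta_n$ used by base station $n$ is uniform on $\{1,\dots,\Delta\}$ with an integer $\Delta\ge 1$, and all of these are independent of each other and of the point process. With noise power $\sigma^2$ and path loss exponent $\alpha$ put $$\mathrm{SINR}=\frac{Pg_y r^{-\alpha}}{\sigma^2+P\sum_{n\ne y}g_n\|z_n\|^{-\alpha}},\qquad \widehat{\mathrm{SINR}}=\frac{P\hat g_y r^{-\alpha}}{\sigma^2+P\sum_{n\ne y,\ \delta_n=\delta_y}\hat g_n\|z_n\|^{-\alpha}},$$ and for $T,T_{FR}>0$ let the edge coverage probability be $\bar F_{\mathrm{FFR,e}}(T)=\mathbb P\big(\widehat{\mathrm{SINR}}>T \,\big|\, \mathrm{SINR}<T_{FR}\big)$. Let $$\rho(T,\alpha)=T^{2/\alpha}\int_{T^{-2/\alpha}}^\infty\frac{du}{1+u^{\alpha/2}},$$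 $$\xi(T,T_{FR},\alpha,\Delta)=\int_1^\infty\Big[1-\frac1{1+T_{FR}x^{-\alpha}}\Big(1-\frac1\Delta\Big(1-\frac1{1+Tx^{-\alpha}}\Big)\Big)\Big]x\,dx .$$ If $\sigma^2=0$ and $\alpha=4$, then $$\bar F_{\mathrm{FFR,e}}(T)=\frac{1+\rho(T_{FR},4)}{\rho(T_{FR},4)}\left(\frac1{1+\frac1\Delta\rho(T,4)}-\frac1{1+2\,\xi(T,T_{FR},4,\Delta)}\right).$$ For $T\ne T_{FR}$, $$\xi(T,T_{FR},4,\Delta)=\frac{2T^{3/2}\arctan\frac1{\sqrt T}-2\arctan\frac1{\sqrt{T_{FR}}}\left(T_{FR}^{3/2}\Delta+T\sqrt{T_{FR}}(1-\Delta)\right)}{4\Delta(T_{FR}-T)}+\frac{\pi\left(T_{FR}^{3/2}\Delta-T^{3/2}\right)+\pi T\sqrt{T_{FR}}(1-\Delta)}{4\Delta(T_{FR}-T)},$$ and for $T=T_{FR}$, $\xi$ equals the limit of this expression as $T\to T_{FR}$, namely $$\xi(T_{FR},T_{FR},4,\Delta)=\frac{\sqrt{T_{FR}}\,\pi(2\Delta+1)}{8\Delta}+\frac{2T_{FR}}{8(T_{FR}+1)\Delta}-\frac{\sqrt{T_{FR}}(2\Delta+1)\cot^{-1}(\sqrt{T_{FR}})}{4\Delta}.$$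 -/

import Mathlib

open MeasureTheory ProbabilityTheory Filter Topology
open scoped ENNReal

noncomputable section

/-- The Euclidean plane in which the base stations live; the typical mobile user is at the
origin. -/
abbrev Plane : Type := EuclideanSpace ℝ (Fin 2)

/-- Number of points (with multiplicity) of the random sequence `z` that lie in `A`. -/
def pointCount {Ω E : Type*} (z : ℕ → Ω → E) (A : Set E) (ω : Ω) : ℕ∞ :=
  {n : ℕ | z n ω ∈ A}.encard

/-- The random sequence `z` is a measurable enumeration of the points of a Poisson point process
with intensity measure `Λ`: counts of sets of finite intensity are Poisson distributed, and counts
of finitely many pairwise disjoint sets are independent. -/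
structure IsPoissonPointProcess {Ω E : Type*} [MeasurableSpace Ω] [MeasurableSpace E]
    (z : ℕ → Ω → E) (Λ : Measure E) (Pr : Measure Ω) : Prop where
  measurable : ∀ n, Measurable (z n)
  poisson_count : ∀ A : Set E, MeasurableSet A → Λ A ≠ ∞ → ∀ k : ℕ,
    Pr {ω | pointCount z A ω = (k : ℕ∞)} =
      ENNReal.ofReal (Real.exp (-(Λ A).toReal) * (Λ A).toReal ^ k / (k.factorial : ℝ))
  indep_count : ∀ (m : ℕ) (A : Fin m → Set E), (∀ i, MeasurableSet (A i)) →
    Pairwise (Function.onFun Disjoint A) → iIndepFun (fun i => pointCount z (A i)) Pr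

/-- The random objects of the cellular network with Strict FFR: `z n` are the base station
locations (homogeneous Poisson process of density `lam`), `g n` is the fading from base station
`n` on the common sub-band, `g' n` the new fading on the sub-bands reserved for edge users, and
`δ n` the reserved sub-band (out of `Δ`) used by base station `n`. Fadings are exponential with
mean `μ` (rate `μ⁻¹`), sub-bands are uniform, and everything is independent. -/
structure IsStrictFFRNetwork {Ω : Type*} [MeasurableSpace Ω] (Pr : Measure Ω) (lam μ : ℝ) (Δ : ℕ)
    (z : ℕ → Ω → Plane) (g g' : ℕ → Ω → ℝ) (δ : ℕ → Ω → Fin Δ) : Prop where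
  poisson : IsPoissonPointProcess z (ENNReal.ofReal lam • (volume : Measure Plane)) Pr
  measurable_g : ∀ n, Measurable (g n)
  measurable_g' : ∀ n, Measurable (g' n)
  measurable_δ : ∀ n, Measurable (δ n)
  law_marks : ∀ n, HasLaw (fun ω => (g n ω, g' n ω, δ n ω))
    ((expMeasure μ⁻¹).prod ((expMeasure μ⁻¹).prod (uniformOn (Set.univ : Set (Fin Δ))))) Pr
  indep_marks : iIndepFun (fun n ω => (g n ω, g' n ω, δ n ω)) Pr
  indep_points_marks :
    IndepFun (fun ω n => z n ω) (fun ω n => (g n ω, g' n ω, δ n ω)) Pr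

/-- Index of the base station closest to the user (almost surely there is exactly one). -/
def servingIndex (x : ℕ → Plane) : ℕ := sInf {n : ℕ | ∀ m, ‖x n‖ ≤ ‖x m‖}

/-- Interference `∑_{n ∈ Z} h n * ‖x n‖ ^ (-α)` from the base stations in `Z`. -/
def interference (α : ℝ) (x : ℕ → Plane) (h : ℕ → ℝ) (Z : Set ℕ) : ℝ≥0∞ :=
  ∑' n : ℕ, Z.indicator (fun n => ENNReal.ofReal (h n * ‖x n‖ ^ (-α))) n

/-- Signal to interference plus noise ratio `P h r ^ (-α) / (σ² + P I)` of the user, served by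
its closest base station at distance `r`, with transmit power `P`, fading `h`, noise power `σsq`
and set of interferers `Z`. -/
def sinr (P σsq α : ℝ) (x : ℕ → Plane) (h : ℕ → ℝ) (Z : Set ℕ) : ℝ≥0∞ :=
  ENNReal.ofReal (P * h (servingIndex x) * ‖x (servingIndex x)‖ ^ (-α)) /
    (ENNReal.ofReal σsq + ENNReal.ofReal P * interference α x h Z)

/-- SINR on the common sub-band: every base station other than the serving one interferes. -/
def commonSinr (P σsq α : ℝ) (x : ℕ → Plane) (g : ℕ → ℝ) : ℝ≥0∞ :=
  sinr P σsq α x g {n | n ≠ servingIndex x}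

/-- SINR on the reserved sub-band: only base stations on the sub-band of the serving one
interfere, and the fading is the new one. -/
def edgeSinr {Δ : ℕ} (P σsq α : ℝ) (x : ℕ → Plane) (g' : ℕ → ℝ) (d : ℕ → Fin Δ) : ℝ≥0∞ :=
  sinr P σsq α x g' {n | n ≠ servingIndex x ∧ d n = d (servingIndex x)}

/-- Coverage probability of a Strict FFR edge user: the conditional probability that the SINR on
the reserved sub-band exceeds `T`, given that the SINR on the common sub-band is below `TFR`. -/
def strictFFREdgeCoverage {Ω : Type*} [MeasurableSpace Ω] (Pr : Measure Ω) {Δ : ℕ}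
    (z : ℕ → Ω → Plane) (g g' : ℕ → Ω → ℝ) (δ : ℕ → Ω → Fin Δ)
    (P σsq α TFR T : ℝ) : ℝ :=
  (cond Pr {ω | commonSinr P σsq α (fun n => z n ω) (fun n => g n ω) < ENNReal.ofReal TFR}
    {ω | ENNReal.ofReal T <
      edgeSinr P σsq α (fun n => z n ω) (fun n => g' n ω) (fun n => δ n ω)}).toReal

/-- `ρ(T, α) = T ^ (2/α) ∫_{T ^ (-2/α)}^∞ 1 / (1 + u ^ (α/2)) du`. -/
def rhoFFR (T α : ℝ) : ℝ :=
  T ^ (2 / α) * ∫ u in Set.Ioi (T ^ (-2 / α)), 1 / (1 + u ^ (α / 2))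

/-- `ξ(T, TFR, α, Δ)`, the exponent in the joint Laplace transform of the two interferences. -/
def xiFFR (T TFR α : ℝ) (Δ : ℕ) : ℝ :=
  ∫ x in Set.Ioi (1 : ℝ),
    (1 - 1 / (1 + TFR * x ^ (-α)) * (1 - 1 / (Δ : ℝ) * (1 - 1 / (1 + T * x ^ (-α))))) * x

/-- Closed form of `ξ(T, TFR, 4, Δ)` for `T ≠ TFR`. -/
def xiClosed (T TFR : ℝ) (Δ : ℕ) : ℝ :=
  (2 * T ^ (3 / 2 : ℝ) * Real.arctan (1 / √T)
      - 2 * Real.arctan (1 / √TFR) * (TFR ^ (3 / 2 : ℝ) * Δ + T * √TFR * (1 - Δ)))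
      / (4 * Δ * (TFR - T))
    + (Real.pi * (TFR ^ (3 / 2 : ℝ) * Δ - T ^ (3 / 2 : ℝ)) + Real.pi * T * √TFR * (1 - Δ))
      / (4 * Δ * (TFR - T))

/-- Closed form of `ξ(TFR, TFR, 4, Δ)`; here `arctan (1 / √TFR)` is `cot⁻¹ (√TFR)`. -/
def xiClosedDiag (TFR : ℝ) (Δ : ℕ) : ℝ :=
  √TFR * Real.pi * (2 * Δ + 1) / (8 * Δ) + 2 * TFR / (8 * (TFR + 1) * Δ)
    - √TFR * (2 * Δ + 1) * Real.arctan (1 / √TFR) / (4 * Δ)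

end

/-! Let `Q(F, T)` be the probability that the common SINR is at least `F` and the reserved SINR
exceeds `T`. With `C` the edge event and `D` the coverage event, `P(C) = 1 - Q(TFR, 0)` and `P(D ∩
C) = P(D) - P(D \ C) = Q(0, T) - Q(TFR, T)`, so one formula for `Q` suffices.

Given the locations, both conditions ask an exponential fading of the server to beat a normalized
interference. Exponential tails turn this into a Laplace transform, and independence makes it a
product over the interferers of `edgeFactor` (`measure_coverage`). Each factor `φ(u)` depends only
on the squared distance ratio `u` of interferer to server.

The areas `λπ‖z n‖²` form a unit rate Poisson process on the half line. If its first point is at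
`s`, the later points are Poisson on `(s, ∞)`, so the mean of the product is `∫ e^(-s) e^(-sI) ds =
1 / (1 + I)` with `I = ∫_1^∞ (1 - φ(u)) du` (`IsPoissonPointProcess.lintegral_expNeg_ratio`). The
process is known only through its counts, so instead of conditioning on `s` the half line is cut
into cells `[q^k, q^(k+1))`. Monotonicity of `φ` bounds the mean on both sides within a factor
`q^3`, and `q → 1`.

For `α = 4`, partial fractions reduce `I` to arctangents (`integral_edgeLoss_of_ne`,
`integral_edgeLoss_self`), and `u = x²` identifies it with `2ξ`. -/

/-! ### Exponentials on `[0, ∞]` and Laplace functionals of independent sums. -/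

/-- The function `a ↦ exp (-a)` on `[0, ∞]`, with `exp (-∞) = 0`. -/
noncomputable def expNeg (a : ℝ≥0∞) : ℝ≥0∞ := EReal.exp (-(a : EReal))

@[simp] lemma expNeg_zero : expNeg 0 = 1 := by simp [expNeg]

@[simp] lemma expNeg_top : expNeg ⊤ = 0 := by simp [expNeg]

lemma expNeg_ofReal {a : ℝ} (ha : 0 ≤ a) :
    expNeg (ENNReal.ofReal a) = ENNReal.ofReal (Real.exp (-a)) := by
  rw [expNeg, EReal.coe_ennreal_ofReal, max_eq_left ha, ← EReal.coe_neg, EReal.exp_coe]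

lemma expNeg_ofReal_neg_log {p : ℝ} (h0 : 0 < p) (h1 : p ≤ 1) :
    expNeg (ENNReal.ofReal (-Real.log p)) = ENNReal.ofReal p := by
  rw [expNeg_ofReal (neg_nonneg.2 (Real.log_nonpos h0.le h1)), neg_neg, Real.exp_log h0]

lemma expNeg_antitone : Antitone expNeg := fun a b h =>
  EReal.exp_monotone (EReal.neg_le_neg_iff.2 (by exact_mod_cast h))

lemma measurable_expNeg : Measurable expNeg := expNeg_antitone.measurable

lemma expNeg_le_one (a : ℝ≥0∞) : expNeg a ≤ 1 := by
  simpa using expNeg_antitone (zero_le (a := a))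

lemma expNeg_add (a b : ℝ≥0∞) : expNeg (a + b) = expNeg a * expNeg b := by
  rw [expNeg, EReal.coe_ennreal_add, EReal.neg_add (by simp) (by simp), sub_eq_add_neg,
    EReal.exp_add]
  rfl

lemma expNeg_sum {ι : Type*} (s : Finset ι) (f : ι → ℝ≥0∞) :
    expNeg (∑ i ∈ s, f i) = ∏ i ∈ s, expNeg (f i) := by
  classical
  induction s using Finset.induction_on with
  | empty => simp
  | insert a s ha ih => rw [Finset.sum_insert ha, Finset.prod_insert ha, expNeg_add, ih]

lemma continuous_expNeg : Continuous expNeg := by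
  have h : Continuous EReal.exp := EReal.expOrderIso.continuous
  exact h.comp (continuous_neg.comp continuous_coe_ennreal_ereal)

lemma tendsto_prod_expNeg (f : ℕ → ℝ≥0∞) :
    Tendsto (fun N => ∏ i ∈ Finset.range N, expNeg (f i)) atTop (𝓝 (expNeg (∑' i, f i))) := by
  simp_rw [← expNeg_sum]
  exact (continuous_expNeg.tendsto _).comp (ENNReal.tendsto_nat_tsum f)

/-- Laplace functional of a sum of independent nonnegative random variables. -/
lemma lintegral_expNeg_tsum {Ω : Type*} [MeasurableSpace Ω] {Pr : Measure Ω}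
    [IsProbabilityMeasure Pr] {X : ℕ → Ω → ℝ≥0∞} {c : ℕ → ℝ≥0∞} (hX : ∀ n, Measurable (X n))
    (hind : ∀ N, iIndepFun (fun i : Fin N => X i) Pr)
    (hc : ∀ n, ∫⁻ ω, expNeg (X n ω) ∂Pr = expNeg (c n)) :
    ∫⁻ ω, expNeg (∑' n, X n ω) ∂Pr = expNeg (∑' n, c n) := by
  have hfin : ∀ N, ∫⁻ ω, ∏ i ∈ Finset.range N, expNeg (X i ω) ∂Pr =
      ∏ i ∈ Finset.range N, expNeg (c i) := by
    intro N
    have h := lintegral_prod_eq_prod_lintegral_of_indepFun Finset.univ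
      (fun (i : Fin N) ω => expNeg (X i ω))
      ((hind N).comp (fun _ => expNeg) fun _ => measurable_expNeg)
      fun i => measurable_expNeg.comp (hX i)
    simp only [hc] at h
    simpa only [Finset.prod_range] using h
  refine tendsto_nhds_unique ?_ (tendsto_prod_expNeg c)
  simp_rw [← hfin]
  refine tendsto_lintegral_of_dominated_convergence (fun _ => 1) (fun N => ?_) (fun N => ?_) ?_ ?_
  · exact Finset.measurable_prod _ fun i _ => measurable_expNeg.comp (hX i)
  · exact ae_of_all _ fun ω => Finset.prod_le_one (by simp) fun i _ => expNeg_le_one _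
  · simp
  · exact ae_of_all _ fun ω => tendsto_prod_expNeg _

lemma expNeg_mul_natCast (c : ℝ≥0∞) (k : ℕ) : expNeg (k * c) = expNeg c ^ k := by
  have h := expNeg_sum (Finset.range k) (fun _ => c)
  simpa using h

/-- Lets the probability of an event be recorded as an exponent, so that an indicator can enter
`lintegral_expNeg_tsum` as one more summand. -/
lemma exists_expNeg_eq {p : ℝ≥0∞} (hp : p ≤ 1) : ∃ c, expNeg c = p := by
  rcases eq_or_ne p 0 with rfl | h0
  · exact ⟨⊤, expNeg_top⟩
  · have ht : p ≠ ⊤ := (hp.trans_lt ENNReal.one_lt_top).ne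
    refine ⟨ENNReal.ofReal (-Real.log p.toReal), ?_⟩
    rw [expNeg_ofReal_neg_log (ENNReal.toReal_pos h0 ht) (ENNReal.toReal_le_of_le_ofReal zero_le_one
      (by simpa using hp)), ENNReal.ofReal_toReal ht]

lemma one_sub_expNeg_le (a : ℝ≥0∞) : 1 - expNeg a ≤ a := by
  rcases eq_or_ne a ⊤ with rfl | ha
  · simp
  · lift a to NNReal using ha
    have h := expNeg_ofReal a.coe_nonneg
    rw [ENNReal.ofReal_coe_nnreal] at h
    rw [h, tsub_le_iff_right, ← ENNReal.ofReal_coe_nnreal, ← ENNReal.ofReal_add (by simp)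
      (Real.exp_pos _).le, ← ENNReal.ofReal_one]
    exact ENNReal.ofReal_le_ofReal (by linarith [Real.add_one_le_exp (-(a : ℝ))])

/-! ### Counts of a Poisson process. -/

lemma pointCount_toENNReal {Ω E : Type*} (z : ℕ → Ω → E) (A : Set E) (ω : Ω) :
    (pointCount z A ω : ℝ≥0∞) = ∑' n, A.indicator (fun _ => 1) (z n ω) := by
  rw [pointCount, ← ENNReal.tsum_set_one, tsum_subtype {n : ℕ | z n ω ∈ A} (fun _ => (1 : ℝ≥0∞))]
  rfl

section Counts

variable {Ω E : Type*} [MeasurableSpace Ω] [MeasurableSpace E] {Pr : Measure Ω} {z : ℕ → Ω → E}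
  {Λ : Measure E}

lemma measurableSet_pointCount_eq (hz : ∀ n, Measurable (z n)) {A : Set E} (hA : MeasurableSet A)
    (k : ℕ∞) : MeasurableSet {ω | pointCount z A ω = k} := by
  have hm : Measurable fun ω => (pointCount z A ω : ℝ≥0∞) := by
    simp_rw [pointCount_toENNReal]
    exact Measurable.tsum fun n => (measurable_const.indicator hA).comp (hz n)
  have : {ω | pointCount z A ω = k} = (fun ω => (pointCount z A ω : ℝ≥0∞)) ⁻¹' {(k : ℝ≥0∞)} := by
    ext ω; simp
  rw [this]
  exact hm (measurableSet_singleton _)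

lemma measurable_pointCount (hz : ∀ n, Measurable (z n)) {A : Set E} (hA : MeasurableSet A) :
    Measurable (pointCount z A) :=
  measurable_to_countable' fun k => measurableSet_pointCount_eq hz hA k

lemma IsPoissonPointProcess.map {F : Type*} [MeasurableSpace F] (h : IsPoissonPointProcess z Λ Pr)
    {f : E → F} (hf : Measurable f) :
    IsPoissonPointProcess (fun n ω => f (z n ω)) (Λ.map f) Pr where
  measurable n := hf.comp (h.measurable n)
  poisson_count A hA hfin k := by
    rw [Measure.map_apply hf hA] at hfin ⊢
    exact h.poisson_count (f ⁻¹' A) (hf hA) hfin k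
  indep_count m A hA hd := h.indep_count m (fun i => f ⁻¹' A i) (fun i => hf (hA i))
    fun i j hij => (hd hij).preimage f

/-- Generating function of the Poisson law, from the exponential series; `p = 1` gives total mass
one. -/
lemma tsum_poisson_mul_pow {m p : ℝ} (hm : 0 ≤ m) (hp : 0 ≤ p) :
    ∑' k : ℕ, ENNReal.ofReal (Real.exp (-m) * m ^ k / (k.factorial : ℝ)) * ENNReal.ofReal p ^ k =
      ENNReal.ofReal (Real.exp (-(m * (1 - p)))) := by
  have hs : HasSum (fun k : ℕ => Real.exp (-m) * ((m * p) ^ k / (k.factorial : ℝ)))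
      (Real.exp (-m) * Real.exp (m * p)) := by
    rw [Real.exp_eq_exp_ℝ]
    exact (NormedSpace.expSeries_div_hasSum_exp (m * p)).mul_left _
  have : Real.exp (-(m * (1 - p))) = Real.exp (-m) * Real.exp (m * p) := by
    rw [← Real.exp_add]; congr 1; ring
  rw [this, ← hs.tsum_eq, ENNReal.ofReal_tsum_of_nonneg (fun k => by positivity) hs.summable]
  congr 1 with k
  rw [← ENNReal.ofReal_pow hp, ← ENNReal.ofReal_mul (by positivity), mul_pow]
  congr 1; ring

/-- The Poisson weights of the finite values already sum to one, which leaves no mass for the value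
`⊤`. -/
lemma IsPoissonPointProcess.ae_ne_top [IsProbabilityMeasure Pr] (h : IsPoissonPointProcess z Λ Pr)
    {A : Set E} (hA : MeasurableSet A) (hfin : Λ A ≠ ∞) : ∀ᵐ ω ∂Pr, pointCount z A ω ≠ ⊤ := by
  have h1 : Pr (⋃ k : ℕ, {ω | pointCount z A ω = (k : ℕ∞)}) = 1 := by
    rw [measure_iUnion]
    · simp_rw [h.poisson_count A hA hfin]
      simpa using tsum_poisson_mul_pow (ENNReal.toReal_nonneg (a := Λ A)) zero_le_one
    · intro i j hij
      refine Set.disjoint_left.2 fun ω h1 h2 => hij ?_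
      exact_mod_cast (h1.symm.trans h2 : (i : ℕ∞) = j)
    · exact fun k => measurableSet_pointCount_eq h.measurable hA k
  have h2 := (prob_compl_eq_zero_iff
    (MeasurableSet.iUnion fun k : ℕ => measurableSet_pointCount_eq h.measurable hA k)).2 h1
  rw [ae_iff]
  refine measure_mono_null (fun ω hω => ?_) h2
  simp only [ne_eq, not_not, Set.mem_ofPred_eq] at hω
  simp [hω]

/-- The generating function at `expNeg c`. Allowing `c = ⊤` includes the void probability, since `0
* ⊤ = 0`. -/
lemma IsPoissonPointProcess.lintegral_expNeg [IsProbabilityMeasure Pr]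
    (h : IsPoissonPointProcess z Λ Pr) {A : Set E} (hA : MeasurableSet A) (hfin : Λ A ≠ ∞)
    (c : ℝ≥0∞) :
    ∫⁻ ω, expNeg (pointCount z A ω * c) ∂Pr = expNeg (Λ A * (1 - expNeg c)) := by
  have hms := fun k : ℕ => measurableSet_pointCount_eq h.measurable hA k
  have h1 : ∀ᵐ ω ∂Pr, expNeg (pointCount z A ω * c) =
      ∑' k : ℕ, {ω | pointCount z A ω = (k : ℕ∞)}.indicator (fun _ => expNeg c ^ k) ω := by
    filter_upwards [h.ae_ne_top hA hfin] with ω hω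
    lift pointCount z A ω to ℕ using hω with n hn
    rw [tsum_eq_single n]
    · rw [Set.indicator_of_mem (by exact hn.symm), ENat.toENNReal_coe, expNeg_mul_natCast]
    · intro k hk
      refine Set.indicator_of_notMem (fun h' => hk ?_) _
      exact_mod_cast (h'.symm.trans hn.symm : (k : ℕ∞) = n)
  rw [lintegral_congr_ae h1, lintegral_tsum
    fun k => (measurable_const.indicator (hms k)).aemeasurable]
  simp_rw [fun k => lintegral_indicator_const (μ := Pr) (hms k), h.poisson_count A hA hfin]
  have hc : expNeg c ≠ ⊤ := ((expNeg_le_one c).trans_lt ENNReal.one_lt_top).ne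
  rw [← ENNReal.ofReal_toReal hc]
  simp_rw [mul_comm (ENNReal.ofReal _ ^ _)]
  have hp1 : (expNeg c).toReal ≤ 1 :=
    ENNReal.toReal_le_of_le_ofReal zero_le_one (by simpa using expNeg_le_one c)
  rw [tsum_poisson_mul_pow ENNReal.toReal_nonneg ENNReal.toReal_nonneg, ← expNeg_ofReal
    (mul_nonneg ENNReal.toReal_nonneg (sub_nonneg.2 hp1)), ENNReal.ofReal_mul
    ENNReal.toReal_nonneg, ENNReal.ofReal_toReal hfin, ENNReal.ofReal_sub _ ENNReal.toReal_nonneg,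
    ENNReal.ofReal_one]

lemma IsPoissonPointProcess.measure_ne_zero [IsProbabilityMeasure Pr]
    (h : IsPoissonPointProcess z Λ Pr) {A : Set E} (hA : MeasurableSet A) (hfin : Λ A ≠ ∞) :
    Pr {ω | pointCount z A ω ≠ 0} = 1 - expNeg (Λ A) := by
  have h0 := h.poisson_count A hA hfin 0
  have hc : {ω | pointCount z A ω ≠ 0} = {ω | pointCount z A ω = ((0 : ℕ) : ℕ∞)}ᶜ := by ext; simp
  rw [hc, prob_compl_eq_one_sub (measurableSet_pointCount_eq h.measurable hA _), h0]
  simp [← expNeg_ofReal, ENNReal.ofReal_toReal hfin]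

lemma IsPoissonPointProcess.measure_eq_one (h : IsPoissonPointProcess z Λ Pr) {A : Set E}
    (hA : MeasurableSet A) (hfin : Λ A ≠ ∞) :
    Pr {ω | pointCount z A ω = 1} = expNeg (Λ A) * Λ A := by
  have h0 := h.poisson_count A hA hfin 1
  simp only [Nat.cast_one] at h0
  rw [h0]
  simp [ENNReal.ofReal_mul (Real.exp_pos _).le, ← expNeg_ofReal, ENNReal.ofReal_toReal hfin]

/-- Joint functional of the counts of a sequence of disjoint sets: the first set is empty, the
count of the second satisfies `p`, and the other counts are weighted by `c`. -/
lemma IsPoissonPointProcess.lintegral_indicator_expNeg_tsum [IsProbabilityMeasure Pr]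
    (h : IsPoissonPointProcess z Λ Pr) {A : ℕ → Set E} (hA : ∀ n, MeasurableSet (A n))
    (hd : Pairwise (Function.onFun Disjoint A)) (hfin : ∀ n, Λ (A n) ≠ ∞) (p : ℕ∞ → Prop)
    (c : ℕ → ℝ≥0∞) :
    ∫⁻ ω, {ω | pointCount z (A 0) ω = 0 ∧ p (pointCount z (A 1) ω)}.indicator
        (fun ω => expNeg (∑' i, pointCount z (A (i + 2)) ω * c i)) ω ∂Pr =
      expNeg (Λ (A 0)) * Pr {ω | p (pointCount z (A 1) ω)} *
        expNeg (∑' i, Λ (A (i + 2)) * (1 - expNeg (c i))) := by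
  classical
  -- Exponents that encode the whole integrand: `expNeg (k * ⊤)` is the indicator of `k = 0`, and
  -- the values `0`, `⊤` encode the indicator of `p`.
  let F : ℕ → ℕ∞ → ℝ≥0∞ := fun n k =>
    match n with
    | 0 => k * ⊤
    | 1 => if p k then 0 else ⊤
    | (i + 2) => k * c i
  have hcm := fun n => measurable_pointCount h.measurable (hA n)
  obtain ⟨b, hb⟩ := exists_expNeg_eq (prob_le_one (μ := Pr) (s := {ω | p (pointCount z (A 1) ω)}))
  let C : ℕ → ℝ≥0∞ := fun n =>
    match n with
    | 0 => Λ (A 0)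
    | 1 => b
    | (i + 2) => Λ (A (i + 2)) * (1 - expNeg (c i))
  have hF : ∀ n, Measurable (F n) := fun n => measurable_of_countable _
  have key := lintegral_expNeg_tsum (Pr := Pr) (X := fun n ω => F n (pointCount z (A n) ω)) (c := C)
    (fun n => (hF n).comp (hcm n)) (fun N => (h.indep_count N (fun i => A i) (fun i => hA i)
      fun i j hij => hd (Fin.val_injective.ne hij)).comp (fun i => F i) fun i => hF i) (by
      intro n
      match n with
      | 0 =>
        have h0 := h.lintegral_expNeg (hA 0) (hfin 0) ⊤
        rw [expNeg_top, tsub_zero, mul_one] at h0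
        exact h0
      | 1 =>
        have hms : MeasurableSet {ω | p (pointCount z (A 1) ω)} :=
          hcm 1 (Set.to_countable {k | p k}).measurableSet
        have : ∀ ω, expNeg (F 1 (pointCount z (A 1) ω)) =
            {ω | p (pointCount z (A 1) ω)}.indicator 1 ω := by
          intro ω
          by_cases hp : p (pointCount z (A 1) ω) <;> simp [F, hp]
        simp_rw [this, C]
        rw [lintegral_indicator_one hms, hb]
      | (i + 2) => exact h.lintegral_expNeg (hA _) (hfin _) (c i))
  have split : ∀ f : ℕ → ℝ≥0∞, ∑' n, f n = f 0 + f 1 + ∑' i, f (i + 2) := by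
    intro f
    rw [tsum_eq_zero_add' ENNReal.summable, tsum_eq_zero_add' ENNReal.summable, add_assoc]
  rw [split C, expNeg_add, expNeg_add, hb] at key
  rw [← key]
  refine lintegral_congr fun ω => ?_
  rw [split fun n => F n (pointCount z (A n) ω), expNeg_add, expNeg_add]
  by_cases h0 : pointCount z (A 0) ω = 0 <;> by_cases hp : p (pointCount z (A 1) ω)
  all_goals simp [F, h0, hp]

end Counts

/-! ### Riemann sums on a geometric grid. -/

lemma lintegral_Ioi_eq_tsum_zpow {q : ℝ} (hq : 1 < q) (G : ℝ → ℝ≥0∞) :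
    ∫⁻ x in Set.Ioi 0, G x = ∑' k : ℤ, ∫⁻ x in Set.Ico (q ^ k) (q ^ (k + 1)), G x := by
  have hq0 : 0 < q := zero_lt_one.trans hq
  have hd := (zpow_right_mono₀ hq.le).pairwise_disjoint_on_Ico_succ
  simp only [Order.succ_eq_add_one] at hd
  rw [← lintegral_iUnion (fun _ => measurableSet_Ico) hd]
  congr 2
  ext x
  simp only [Set.mem_Ioi, Set.mem_iUnion]
  refine ⟨fun hx => exists_mem_Ico_zpow hx hq, fun ⟨k, hk⟩ => (zpow_pos hq0 k).trans_le hk.1⟩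

lemma lintegral_Ici_eq_tsum_pow {q : ℝ} (hq : 1 < q) (G : ℝ → ℝ≥0∞) :
    ∫⁻ x in Set.Ici 1, G x = ∑' k : ℕ, ∫⁻ x in Set.Ico (q ^ k) (q ^ (k + 1)), G x := by
  have hd := (pow_right_mono₀ hq.le).pairwise_disjoint_on_Ico_succ
  simp only [Order.succ_eq_add_one] at hd
  rw [← lintegral_iUnion (fun _ => measurableSet_Ico) hd]
  congr 2
  ext x
  simp only [Set.mem_Ici, Set.mem_iUnion]
  refine ⟨fun hx => exists_nat_pow_near hx hq, fun ⟨k, hk⟩ => (one_le_pow₀ hq.le).trans hk.1⟩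

lemma AntitoneOn.mul_le_setLIntegral_Ico {G : ℝ → ℝ≥0∞} (hG : AntitoneOn G (Set.Ioi 0)) {a b : ℝ}
    (ha : 0 < a) : ENNReal.ofReal (b - a) * G b ≤ ∫⁻ x in Set.Ico a b, G x := by
  rw [mul_comm, ← Real.volume_Ico, ← setLIntegral_const]
  exact setLIntegral_mono' measurableSet_Ico fun x hx =>
    hG (ha.trans_le hx.1) (ha.trans_le (hx.1.trans hx.2.le)) hx.2.le

lemma AntitoneOn.setLIntegral_Ico_le {G : ℝ → ℝ≥0∞} (hG : AntitoneOn G (Set.Ioi 0)) {a b : ℝ}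
    (ha : 0 < a) : ∫⁻ x in Set.Ico a b, G x ≤ ENNReal.ofReal (b - a) * G a := by
  rw [mul_comm, ← Real.volume_Ico, ← setLIntegral_const]
  exact setLIntegral_mono' measurableSet_Ico fun x hx => hG ha (ha.trans_le hx.1) hx.1

lemma ofReal_zpow_shift {q : ℝ} (hq : 1 < q) (k : ℤ) :
    ENNReal.ofReal (q ^ (k + 1 + 1) - q ^ (k + 1)) =
      ENNReal.ofReal q * ENNReal.ofReal (q ^ (k + 1) - q ^ k) := by
  have hq0 : 0 < q := zero_lt_one.trans hq
  rw [← ENNReal.ofReal_mul hq0.le, mul_sub, zpow_add_one₀ hq0.ne' (k + 1), zpow_add_one₀ hq0.ne' k]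
  congr 1; ring

/-- The left endpoint of a cell is the right endpoint of the preceding cell, which is `q` times
shorter; a shift by one cell therefore costs a factor `q`. -/
lemma tsum_zpow_mul_le {q : ℝ} (hq : 1 < q) {G : ℝ → ℝ≥0∞} (hG : AntitoneOn G (Set.Ioi 0)) :
    ∑' k : ℤ, ENNReal.ofReal (q ^ (k + 1) - q ^ k) * G (q ^ k) ≤
      ENNReal.ofReal q * ∫⁻ x in Set.Ioi 0, G x := by
  rw [lintegral_Ioi_eq_tsum_zpow hq, ← (Equiv.addRight (1 : ℤ)).tsum_eq, ← ENNReal.tsum_mul_left]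
  refine ENNReal.tsum_le_tsum fun k => ?_
  rw [Equiv.coe_addRight, ofReal_zpow_shift hq, mul_assoc]
  gcongr
  exact hG.mul_le_setLIntegral_Ico (zpow_pos (zero_lt_one.trans hq) _)

lemma lintegral_Ioi_le_tsum_zpow_mul {q : ℝ} (hq : 1 < q) {G : ℝ → ℝ≥0∞}
    (hG : AntitoneOn G (Set.Ioi 0)) :
    ∫⁻ x in Set.Ioi 0, G x ≤
      ENNReal.ofReal q * ∑' k : ℤ, ENNReal.ofReal (q ^ (k + 1) - q ^ k) * G (q ^ (k + 1)) := by
  rw [lintegral_Ioi_eq_tsum_zpow hq, ← (Equiv.addRight (1 : ℤ)).tsum_eq, ← ENNReal.tsum_mul_left]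
  refine ENNReal.tsum_le_tsum fun k => ?_
  rw [Equiv.coe_addRight, ← mul_assoc, ← ofReal_zpow_shift hq]
  exact hG.setLIntegral_Ico_le (zpow_pos (zero_lt_one.trans hq) _)

lemma ofReal_pow_shift {q : ℝ} (hq : 1 < q) (i m : ℕ) :
    ENNReal.ofReal (q ^ (i + m + 1) - q ^ (i + m)) =
      ENNReal.ofReal (q ^ m) * ENNReal.ofReal (q ^ (i + 1) - q ^ i) := by
  have hq0 : 0 < q := zero_lt_one.trans hq
  rw [← ENNReal.ofReal_mul (by positivity)]
  congr 1; ring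

/-- The two cells covering `[1, q²)` contribute at most `q² - 1` because `G ≤ 1`, and the summand
`1` completes this to `q²`. The remaining cells are shifted by one. -/
lemma one_add_lintegral_Ici_le {q : ℝ} (hq : 1 < q) {G : ℝ → ℝ≥0∞} (hG : AntitoneOn G (Set.Ioi 0))
    (hG1 : ∀ x, G x ≤ 1) :
    1 + ∫⁻ x in Set.Ici 1, G x ≤ ENNReal.ofReal (q ^ 2) *
      (1 + ∑' i : ℕ, ENNReal.ofReal (q ^ (i + 2) - q ^ (i + 1)) * G (q ^ (i + 2))) := by
  have hq0 : 0 < q := zero_lt_one.trans hq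
  have h1 : ∫⁻ x in Set.Ici 1, G x ≤ ∑' i : ℕ, ENNReal.ofReal (q ^ (i + 1) - q ^ i) * G (q ^ i) := by
    rw [lintegral_Ici_eq_tsum_pow hq]
    exact ENNReal.tsum_le_tsum fun i => hG.setLIntegral_Ico_le (pow_pos hq0 _)
  have h2 : ∑' i : ℕ, ENNReal.ofReal (q ^ (i + 1) - q ^ i) * G (q ^ i) ≤
      ENNReal.ofReal (q - 1) + (ENNReal.ofReal (q ^ 2 - q) + ENNReal.ofReal (q ^ 2) *
        ∑' i : ℕ, ENNReal.ofReal (q ^ (i + 2) - q ^ (i + 1)) * G (q ^ (i + 2))) := by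
    rw [tsum_eq_zero_add' ENNReal.summable, tsum_eq_zero_add' ENNReal.summable,
      ← ENNReal.tsum_mul_left]
    refine add_le_add ?_ (add_le_add ?_ (ENNReal.tsum_le_tsum fun i => ?_))
    · simpa using mul_le_mul_right (hG1 1) (ENNReal.ofReal (q - 1))
    · simpa using mul_le_mul_right (hG1 q) (ENNReal.ofReal (q ^ 2 - q))
    · rw [ofReal_pow_shift hq (i + 1) 1, ← mul_assoc]
      gcongr
      · exact hq.le
      · norm_num
  have h3 : (1 : ℝ≥0∞) + ENNReal.ofReal (q - 1) + ENNReal.ofReal (q ^ 2 - q) =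
      ENNReal.ofReal (q ^ 2) := by
    rw [← ENNReal.ofReal_one, ← ENNReal.ofReal_add zero_le_one (by linarith),
      ← ENNReal.ofReal_add (by linarith) (by nlinarith)]
    congr 1; ring
  calc _ ≤ _ := add_le_add_right (h1.trans h2) 1
    _ = _ := by rw [mul_add, mul_one, ← h3]; ring

/-- The term `i = 0` is at most `q² - q`, and `1 + q² - q ≤ q²`. The other terms are compared with
cells two steps lower, at a cost of `q²`. -/
lemma one_add_tsum_le {q : ℝ} (hq : 1 < q) {G : ℝ → ℝ≥0∞} (hG : AntitoneOn G (Set.Ioi 0))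
    (hG1 : ∀ x, G x ≤ 1) :
    1 + ∑' i : ℕ, ENNReal.ofReal (q ^ (i + 2) - q ^ (i + 1)) * G (q ^ i) ≤
      ENNReal.ofReal (q ^ 2) * (1 + ∫⁻ x in Set.Ici 1, G x) := by
  have hq0 : 0 < q := zero_lt_one.trans hq
  have h2 : ∑' i : ℕ, ENNReal.ofReal (q ^ (i + 2) - q ^ (i + 1)) * G (q ^ i) ≤
      ENNReal.ofReal (q ^ 2 - q) + ENNReal.ofReal (q ^ 2) * ∫⁻ x in Set.Ici 1, G x := by
    rw [tsum_eq_zero_add' ENNReal.summable, lintegral_Ici_eq_tsum_pow hq, ← ENNReal.tsum_mul_left]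
    refine add_le_add ?_ (ENNReal.tsum_le_tsum fun i => ?_)
    · simpa using mul_le_mul_right (hG1 1) (ENNReal.ofReal (q ^ 2 - q))
    · rw [show i + 1 + 1 = i + 2 from rfl, show i + 1 + 2 = i + 2 + 1 from rfl,
        ofReal_pow_shift hq i 2, mul_assoc]
      gcongr
      exact hG.mul_le_setLIntegral_Ico (pow_pos hq0 _)
  calc _ ≤ _ := add_le_add_right h2 1
    _ = ENNReal.ofReal (1 + (q ^ 2 - q)) + ENNReal.ofReal (q ^ 2) * ∫⁻ x in Set.Ici 1, G x := by
      rw [ENNReal.ofReal_add zero_le_one (by nlinarith), ENNReal.ofReal_one, add_assoc]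
    _ ≤ _ := by
      rw [mul_add, mul_one]
      gcongr
      linarith

/-- The final integral over the position of the first point, with `a = 1 + I`, possibly infinite. -/
lemma lintegral_Ioi_expNeg_mul {a : ℝ≥0∞} (ha : a ≠ 0) :
    ∫⁻ x in Set.Ioi (0 : ℝ), expNeg (ENNReal.ofReal x * a) = a⁻¹ := by
  rcases eq_or_ne a ⊤ with rfl | hat
  · rw [setLIntegral_congr_fun (g := fun _ => 0) measurableSet_Ioi fun x hx => by
      rw [ENNReal.mul_top (by simpa using hx), expNeg_top]]
    simp
  · obtain ⟨b, hb, rfl⟩ : ∃ b : ℝ, 0 < b ∧ a = ENNReal.ofReal b :=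
      ⟨a.toReal, ENNReal.toReal_pos ha hat, (ENNReal.ofReal_toReal hat).symm⟩
    have hi := integrableOn_exp_mul_Ioi (neg_lt_zero.2 hb) 0
    have hv := integral_exp_mul_Ioi (neg_lt_zero.2 hb) 0
    rw [← ENNReal.ofReal_inv_of_pos hb, show b⁻¹ = ∫ x in Set.Ioi 0, Real.exp (-b * x) by
      rw [hv]; simp, ofReal_integral_eq_lintegral_ofReal hi (ae_of_all _ fun _ => (Real.exp_pos _).le)]
    refine setLIntegral_congr_fun measurableSet_Ioi fun x hx => ?_
    have hx' : 0 ≤ x := le_of_lt hx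
    rw [← ENNReal.ofReal_mul hx', expNeg_ofReal (by positivity)]
    congr 2; ring

/-! ### Cells adapted to the first point, and ratios to that point. -/

/-- The partition of `(-∞, ∞)` into `(-∞, q ^ k)` and the geometric intervals
`[q ^ (k + j), q ^ (k + j + 1))`. -/
def geomPartition (q : ℝ) (k : ℤ) : ℕ → Set ℝ
  | 0 => Set.Iio (q ^ k)
  | j + 1 => Set.Ico (q ^ (k + j)) (q ^ (k + j + 1))

lemma measurableSet_geomPartition (q : ℝ) (k : ℤ) (n : ℕ) :
    MeasurableSet (geomPartition q k n) := by
  cases n with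
  | zero => exact measurableSet_Iio
  | succ j => exact measurableSet_Ico

lemma geomPartition_one (q : ℝ) (k : ℤ) :
    geomPartition q k 1 = Set.Ico (q ^ k) (q ^ (k + 1)) := by
  simp [geomPartition]

lemma geomPartition_subset_Iio {q : ℝ} (hq : 1 < q) (k : ℤ) {m n : ℕ} (h : m ≤ n) :
    geomPartition q k m ⊆ Set.Iio (q ^ (k + n)) := by
  have hmono := zpow_right_mono₀ (a := q) hq.le
  intro x hx
  cases m with
  | zero => exact lt_of_lt_of_le hx (hmono (by omega))
  | succ j => exact lt_of_lt_of_le hx.2 (hmono (by omega))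

lemma pairwise_disjoint_geomPartition {q : ℝ} (hq : 1 < q) (k : ℤ) :
    Pairwise (Function.onFun Disjoint (geomPartition q k)) := by
  have key : ∀ m n, m < n → Disjoint (geomPartition q k m) (geomPartition q k n) := by
    intro m n hmn
    obtain ⟨n, rfl⟩ : ∃ j, n = j + 1 := ⟨n - 1, by omega⟩
    rw [Set.disjoint_left]
    intro x hm hn
    exact absurd (geomPartition_subset_Iio hq k (Nat.lt_succ_iff.1 hmn) hm) (not_lt.2 hn.1)
  intro m n hmn
  rcases hmn.lt_or_gt with h | h
  · exact key m n h
  · exact (key n m h).symm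

lemma exists_mem_geomPartition {q : ℝ} (hq : 1 < q) (k : ℤ) (x : ℝ) :
    ∃ n, x ∈ geomPartition q k n := by
  rcases lt_or_ge x (q ^ k) with h | h
  · exact ⟨0, h⟩
  · obtain ⟨l, hl⟩ := exists_mem_Ico_zpow ((zpow_pos (zero_lt_one.trans hq) k).trans_le h) hq
    have hkl : k < l + 1 := (zpow_lt_zpow_iff_right₀ hq).1 (h.trans_lt hl.2)
    refine ⟨(l - k).toNat + 1, ?_⟩
    have : k + ((l - k).toNat : ℤ) = l := by omega
    simpa only [geomPartition, this] using hl

/-- A ratio of points in two cells is known up to a factor `q²`; its two ends are the arguments of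
`ψ` in the two bounds. -/
lemma div_mem_Ioo_of_mem_geomPartition {q : ℝ} (hq : 1 < q) {k : ℤ} {i : ℕ} {s r : ℝ}
    (hs : s ∈ geomPartition q k (i + 2)) (hr : r ∈ geomPartition q k 1) :
    s / r ∈ Set.Ioo (q ^ i) (q ^ (i + 2)) := by
  have hq0 : 0 < q := zero_lt_one.trans hq
  rw [geomPartition_one] at hr
  have hk := zpow_pos hq0 k
  have hr0 : 0 < r := hk.trans_le hr.1
  have e1 : q ^ (k + ((i + 1 : ℕ) : ℤ)) = q ^ i * q ^ (k + 1) := by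
    rw [← zpow_natCast, ← zpow_add₀ hq0.ne']; congr 1; push_cast; ring
  have e2 : q ^ (k + ((i + 1 : ℕ) : ℤ) + 1) = q ^ (i + 2) * q ^ k := by
    rw [← zpow_natCast, ← zpow_add₀ hq0.ne']; congr 1; push_cast; ring
  have h1 := hs.1
  have h2 := hs.2
  rw [e1] at h1
  rw [e2] at h2
  constructor
  · rw [lt_div_iff₀ hr0]
    exact (mul_lt_mul_of_pos_left hr.2 (pow_pos hq0 _)).trans_le h1
  · rw [div_lt_iff₀ hr0]
    exact h2.trans_le (mul_le_mul_of_nonneg_left hr.1 (by positivity))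

section Ratio

variable {Ω : Type*} {t : ℕ → Ω → ℝ} {ψ : ℝ → ℝ≥0∞}

lemma tsum_pointCount_mul (t : ℕ → Ω → ℝ) (A : ℕ → Set ℝ) (c : ℕ → ℝ≥0∞) (ω : Ω) :
    ∑' i, (pointCount t (A i) ω : ℝ≥0∞) * c i =
      ∑' n, ∑' i, (A i).indicator (fun _ => c i) (t n ω) := by
  rw [ENNReal.tsum_comm]
  congr 1 with i
  rw [pointCount_toENNReal, ← ENNReal.tsum_mul_right]
  congr 1 with n
  by_cases h : t n ω ∈ A i <;> simp [h]

/-- Other points in cells `0` and `1` are dropped, which only lowers the sum; for the rest the ratio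
is below `q ^ (i + 2)`. -/
lemma tsum_pointCount_mul_le {q : ℝ} (hq : 1 < q) (hψ : AntitoneOn ψ (Set.Ioi 0)) {k : ℤ} {ω : Ω}
    {y : ℕ} (hy : t y ω ∈ geomPartition q k 1) :
    ∑' i, (pointCount t (geomPartition q k (i + 2)) ω : ℝ≥0∞) * ψ (q ^ (i + 2)) ≤
      ∑' n, if n = y then 0 else ψ (t n ω / t y ω) := by
  have hq0 : 0 < q := zero_lt_one.trans hq
  have hd := pairwise_disjoint_geomPartition hq k
  rw [tsum_pointCount_mul t (fun i => geomPartition q k (i + 2))]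
  refine ENNReal.tsum_le_tsum fun n => ?_
  by_cases h : ∃ i, t n ω ∈ geomPartition q k (i + 2)
  · obtain ⟨i, hi⟩ := h
    rw [tsum_eq_single i, Set.indicator_of_mem hi, if_neg]
    · have hm := div_mem_Ioo_of_mem_geomPartition hq hi hy
      exact hψ ((pow_pos hq0 i).trans hm.1) (pow_pos hq0 (i + 2)) hm.2.le
    · rintro rfl
      exact Set.disjoint_left.1 (hd (show 1 ≠ i + 2 by omega)) hy hi
    · intro j hj
      exact Set.indicator_of_notMem
        (Set.disjoint_left.1 (hd (show i + 2 ≠ j + 2 by omega)) hi) _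
  · push Not at h
    simp [h]

/-- With cell `0` empty and only the first point in cell `1`, no other point escapes the cells `i +
2`, where the ratio exceeds `q ^ i`. -/
lemma tsum_le_tsum_pointCount_mul {q : ℝ} (hq : 1 < q) (hψ : AntitoneOn ψ (Set.Ioi 0)) {k : ℤ}
    {ω : Ω} {y : ℕ} (hy : t y ω ∈ geomPartition q k 1)
    (h0 : pointCount t (geomPartition q k 0) ω = 0)
    (h1 : pointCount t (geomPartition q k 1) ω = 1) :
    (∑' n, if n = y then 0 else ψ (t n ω / t y ω)) ≤
      ∑' i, (pointCount t (geomPartition q k (i + 2)) ω : ℝ≥0∞) * ψ (q ^ i) := by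
  have hq0 : 0 < q := zero_lt_one.trans hq
  rw [tsum_pointCount_mul t (fun i => geomPartition q k (i + 2))]
  refine ENNReal.tsum_le_tsum fun n => ?_
  split_ifs with hn
  · simp
  · obtain ⟨j, hj⟩ := exists_mem_geomPartition hq k (t n ω)
    match j, hj with
    | 0, hj => exact absurd hj (Set.eq_empty_iff_forall_notMem.1 (Set.encard_eq_zero.1 h0) n)
    | 1, hj =>
      obtain ⟨a, ha⟩ := Set.encard_eq_one.1 h1
      have e1 : n ∈ ({a} : Set ℕ) := ha ▸ hj
      have e2 : y ∈ ({a} : Set ℕ) := ha ▸ hy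
      exact absurd (e1.trans e2.symm) hn
    | i + 2, hj =>
      have hm := div_mem_Ioo_of_mem_geomPartition hq hj hy
      refine le_trans ?_ (ENNReal.le_tsum i)
      rw [Set.indicator_of_mem hj]
      exact hψ (pow_pos hq0 i) ((pow_pos hq0 i).trans hm.1) hm.1.le

lemma mem_geomPartition_one_of_pointCount {q : ℝ} {k : ℤ} {ω : Ω} {y : ℕ}
    (hy : ∀ m, t y ω ≤ t m ω) (h0 : pointCount t (geomPartition q k 0) ω = 0)
    (h1 : pointCount t (geomPartition q k 1) ω ≠ 0) : t y ω ∈ geomPartition q k 1 := by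
  rw [geomPartition_one] at h1 ⊢
  obtain ⟨n, hn⟩ := Set.encard_ne_zero.1 h1
  exact ⟨not_lt.1 (Set.eq_empty_iff_forall_notMem.1 (Set.encard_eq_zero.1 h0) y),
    (hy n).trans_lt hn.2⟩

lemma pointCount_geomPartition_of_mem {q : ℝ} {k : ℤ} {ω : Ω} {y : ℕ}
    (hy : ∀ m, t y ω ≤ t m ω) (hk : t y ω ∈ geomPartition q k 1) :
    pointCount t (geomPartition q k 0) ω = 0 ∧ pointCount t (geomPartition q k 1) ω ≠ 0 := by
  refine ⟨Set.encard_eq_zero.2 (Set.eq_empty_of_forall_notMem fun n hn => ?_),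
    Set.encard_ne_zero.2 ⟨y, hk⟩⟩
  rw [geomPartition_one] at hk
  exact absurd (lt_of_lt_of_le hn (hk.1.trans (hy n))) (lt_irrefl _)

end Ratio

/-! ### The unit rate process seen from its first point. -/

section UnitRate

variable {Λ : Measure ℝ}

lemma measure_Ico_of_measure_Iio (hΛ : ∀ b, Λ (Set.Iio b) = ENNReal.ofReal b) {a b : ℝ}
    (ha : 0 ≤ a) (hab : a ≤ b) : Λ (Set.Ico a b) = ENNReal.ofReal (b - a) := by
  have h : Set.Ico a b = Set.Iio b \ Set.Iio a := by ext x; simp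
  rw [h, measure_sdiff (Set.Iio_subset_Iio hab) measurableSet_Iio.nullMeasurableSet
    (by rw [hΛ]; exact ENNReal.ofReal_ne_top), hΛ, hΛ, ENNReal.ofReal_sub _ ha]

lemma measure_Iic_zero_of_measure_Iio (hΛ : ∀ b, Λ (Set.Iio b) = ENNReal.ofReal b) :
    Λ (Set.Iic 0) = 0 := by
  refine le_antisymm (le_of_forall_gt fun c hc => ?_) (zero_le)
  obtain ⟨b, hb0, hb⟩ := ENNReal.lt_iff_exists_real_btwn.1 hc
  refine lt_of_le_of_lt (measure_mono fun x hx => ?_) ((hΛ b).trans_lt hb.2)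
  exact lt_of_le_of_lt hx (ENNReal.ofReal_pos.1 hb.1)

lemma measure_geomPartition_ne_top (hΛ : ∀ b, Λ (Set.Iio b) = ENNReal.ofReal b) {q : ℝ}
    (hq : 1 < q) (k : ℤ) (n : ℕ) : Λ (geomPartition q k n) ≠ ∞ :=
  ((measure_mono (geomPartition_subset_Iio hq k le_rfl)).trans_lt
    (by rw [hΛ]; exact ENNReal.ofReal_lt_top)).ne

lemma tsum_measure_geomPartition (hΛ : ∀ b, Λ (Set.Iio b) = ENNReal.ofReal b) {q : ℝ}
    (hq : 1 < q) (k : ℤ) (d : ℕ → ℝ≥0∞) :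
    ∑' i, Λ (geomPartition q k (i + 2)) * d i =
      ENNReal.ofReal (q ^ k) * ∑' i, ENNReal.ofReal (q ^ (i + 2) - q ^ (i + 1)) * d i := by
  have hq0 : 0 < q := zero_lt_one.trans hq
  rw [← ENNReal.tsum_mul_left]
  congr 1 with i
  rw [← mul_assoc, ← ENNReal.ofReal_mul (zpow_pos hq0 k).le, geomPartition,
    measure_Ico_of_measure_Iio hΛ (zpow_pos hq0 _).le (zpow_le_zpow_right₀ hq.le (by omega))]
  congr 2
  rw [mul_sub, ← zpow_natCast, ← zpow_natCast, ← zpow_add₀ hq0.ne', ← zpow_add₀ hq0.ne']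
  push_cast
  congr 2; ring

variable {Ω : Type*} [MeasurableSpace Ω] {Pr : Measure Ω} {t : ℕ → Ω → ℝ}
  {ψ : ℝ → ℝ≥0∞} {y : Ω → ℕ}

lemma IsPoissonPointProcess.ae_pos (h : IsPoissonPointProcess t Λ Pr)
    (hΛ : ∀ b, Λ (Set.Iio b) = ENNReal.ofReal b) : ∀ᵐ ω ∂Pr, ∀ n, 0 < t n ω := by
  have h0 := h.poisson_count (Set.Iic 0) measurableSet_Iic
    (by rw [measure_Iic_zero_of_measure_Iio hΛ]; simp) 0
  -- The count of the empty set is identically `0` and Poisson of mean `0`, which forces total mass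
  -- one.
  have hP : Pr Set.univ = 1 := by
    have h1 := h.poisson_count ∅ MeasurableSet.empty (by simp) 0
    simpa [pointCount] using h1
  have : IsProbabilityMeasure Pr := ⟨hP⟩
  rw [measure_Iic_zero_of_measure_Iio hΛ] at h0
  simp only [ENNReal.toReal_zero, neg_zero, Real.exp_zero, pow_zero, mul_one, Nat.factorial_zero,
    Nat.cast_one, div_one, ENNReal.ofReal_one] at h0
  have hae := (prob_compl_eq_zero_iff (measurableSet_pointCount_eq h.measurable
    measurableSet_Iic _)).2 h0
  rw [ae_iff]
  refine measure_mono_null ?_ hae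
  intro ω hω hc
  exact hω fun n =>
    not_le.1 (Set.eq_empty_iff_forall_notMem.1 (Set.encard_eq_zero.1 hc) n)

/-- Only finitely many points lie below any integer, so a minimum over a finite set suffices. -/
lemma IsPoissonPointProcess.ae_exists_forall_le [IsProbabilityMeasure Pr]
    (h : IsPoissonPointProcess t Λ Pr) (hΛ : ∀ b, Λ (Set.Iio b) = ENNReal.ofReal b) :
    ∀ᵐ ω ∂Pr, ∃ n, ∀ m, t n ω ≤ t m ω := by
  have hfin : ∀ᵐ ω ∂Pr, ∀ N : ℕ, pointCount t (Set.Iio (N : ℝ)) ω ≠ ⊤ :=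
    ae_all_iff.2 fun N => h.ae_ne_top measurableSet_Iio (by rw [hΛ]; exact ENNReal.ofReal_ne_top)
  filter_upwards [hfin] with ω hω
  obtain ⟨N, hN⟩ := exists_nat_gt (t 0 ω)
  have hS : {n | t n ω ∈ Set.Iio (N : ℝ)}.Finite := Set.encard_ne_top_iff.1 (hω N)
  obtain ⟨n, hn, hmin⟩ := Set.exists_min_image _ (fun n => t n ω) hS ⟨0, hN⟩
  refine ⟨n, fun m => ?_⟩
  by_cases hm : t m ω < N
  · exact hmin m hm
  · exact (le_of_lt hn).trans (not_lt.1 hm)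

lemma antitoneOn_one_sub_expNeg (hψ : AntitoneOn ψ (Set.Ioi 0)) :
    AntitoneOn (fun u => 1 - expNeg (ψ u)) (Set.Ioi 0) :=
  fun _ ha _ hb hab => tsub_le_tsub_left (expNeg_antitone (hψ ha hb hab)) 1

lemma antitone_expNeg_ofReal_mul (a : ℝ≥0∞) : Antitone fun x : ℝ => expNeg (ENNReal.ofReal x * a) :=
  fun _ _ h => expNeg_antitone (mul_le_mul_left (ENNReal.ofReal_le_ofReal h) a)

lemma measurable_expNeg_tsum_pointCount (h : IsPoissonPointProcess t Λ Pr) (q : ℝ) (k : ℤ)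
    (p : ℕ∞ → Prop) (c : ℕ → ℝ≥0∞) :
    Measurable ({ω | pointCount t (geomPartition q k 0) ω = 0 ∧
        p (pointCount t (geomPartition q k 1) ω)}.indicator
      (fun ω => expNeg (∑' i, pointCount t (geomPartition q k (i + 2)) ω * c i))) := by
  have hm := fun n => measurable_pointCount h.measurable (measurableSet_geomPartition q k n)
  refine Measurable.indicator (measurable_expNeg.comp (Measurable.tsum fun i => ?_)) ?_
  · exact ((measurable_of_countable _).comp (hm (i + 2))).mul_const _
  · exact (measurableSet_pointCount_eq h.measurable (measurableSet_geomPartition q k 0) 0).inter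
      ((hm 1) (Set.to_countable {k | p k}).measurableSet)

/-- If the first point is in cell `k`, nothing lies below `q ^ k` and the cell is occupied, with
probability `1 - e^(-m) ≤ m` for a cell of length `m`. Summing over `k` gives a left Riemann sum of
`e^(-x(1 + S))`, which costs `q`; comparing `S` with the integral costs `q²`. -/
lemma IsPoissonPointProcess.lintegral_expNeg_ratio_le [IsProbabilityMeasure Pr]
    (h : IsPoissonPointProcess t Λ Pr) (hΛ : ∀ b, Λ (Set.Iio b) = ENNReal.ofReal b)
    (hψ : AntitoneOn ψ (Set.Ioi 0)) (hy : ∀ᵐ ω ∂Pr, ∀ m, t (y ω) ω ≤ t m ω) {q : ℝ} (hq : 1 < q) :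
    ∫⁻ ω, expNeg (∑' n, if n = y ω then 0 else ψ (t n ω / t (y ω) ω)) ∂Pr ≤
      ENNReal.ofReal (q ^ 3) * (1 + ∫⁻ u in Set.Ici 1, (1 - expNeg (ψ u)))⁻¹ := by
  have hq0 : 0 < q := zero_lt_one.trans hq
  set S := ∑' i : ℕ, ENNReal.ofReal (q ^ (i + 2) - q ^ (i + 1)) * (1 - expNeg (ψ (q ^ (i + 2))))
    with hS
  have hpt : ∀ᵐ ω ∂Pr, expNeg (∑' n, if n = y ω then 0 else ψ (t n ω / t (y ω) ω)) ≤
      ∑' k : ℤ, {ω | pointCount t (geomPartition q k 0) ω = 0 ∧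
        pointCount t (geomPartition q k 1) ω ≠ 0}.indicator
      (fun ω => expNeg (∑' i, pointCount t (geomPartition q k (i + 2)) ω * ψ (q ^ (i + 2)))) ω := by
    filter_upwards [hy, h.ae_pos hΛ] with ω hω hpos
    obtain ⟨k, hk⟩ := exists_mem_Ico_zpow (hpos (y ω)) hq
    rw [← geomPartition_one] at hk
    refine le_trans ?_ (ENNReal.le_tsum k)
    rw [Set.indicator_of_mem (show ω ∈ {ω | pointCount t (geomPartition q k 0) ω = 0 ∧
      pointCount t (geomPartition q k 1) ω ≠ 0} from pointCount_geomPartition_of_mem hω hk)]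
    exact expNeg_antitone (tsum_pointCount_mul_le hq hψ hk)
  refine (lintegral_mono_ae hpt).trans ?_
  rw [lintegral_tsum fun k => (measurable_expNeg_tsum_pointCount h q k (· ≠ 0) _).aemeasurable]
  have hterm : ∀ k : ℤ, ∫⁻ ω, {ω | pointCount t (geomPartition q k 0) ω = 0 ∧
        pointCount t (geomPartition q k 1) ω ≠ 0}.indicator
      (fun ω => expNeg (∑' i, pointCount t (geomPartition q k (i + 2)) ω * ψ (q ^ (i + 2)))) ω ∂Pr ≤
      ENNReal.ofReal (q ^ (k + 1) - q ^ k) * expNeg (ENNReal.ofReal (q ^ k) * (1 + S)) := by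
    intro k
    have hone : Λ (geomPartition q k 1) = ENNReal.ofReal (q ^ (k + 1) - q ^ k) := by
      rw [geomPartition_one, measure_Ico_of_measure_Iio hΛ (zpow_pos hq0 _).le
        (zpow_le_zpow_right₀ hq.le (by omega))]
    rw [h.lintegral_indicator_expNeg_tsum (measurableSet_geomPartition q k)
      (pairwise_disjoint_geomPartition hq k) (measure_geomPartition_ne_top hΛ hq k) (· ≠ 0),
      h.measure_ne_zero (measurableSet_geomPartition q k 1) (measure_geomPartition_ne_top hΛ hq k 1),
      tsum_measure_geomPartition hΛ hq, mul_add, expNeg_add, mul_one, ← hone, ← hS,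
      show Λ (geomPartition q k 0) = ENNReal.ofReal (q ^ k) from hΛ _]
    calc _ ≤ expNeg (ENNReal.ofReal (q ^ k)) * Λ (geomPartition q k 1) *
          expNeg (ENNReal.ofReal (q ^ k) * S) := by
          gcongr
          exact one_sub_expNeg_le _
      _ = _ := by ring
  refine (ENNReal.tsum_le_tsum hterm).trans ((tsum_zpow_mul_le hq
    ((antitone_expNeg_ofReal_mul (1 + S)).antitoneOn _)).trans ?_)
  rw [lintegral_Ioi_expNeg_mul (by simp)]
  have hH := one_add_lintegral_Ici_le hq (antitoneOn_one_sub_expNeg hψ) fun _ => tsub_le_self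
  rw [← hS] at hH
  have hq2 : ENNReal.ofReal (q ^ 2) ≠ 0 := by simpa using hq0.ne'
  calc ENNReal.ofReal q * (1 + S)⁻¹
      = ENNReal.ofReal (q ^ 3) * (ENNReal.ofReal (q ^ 2) * (1 + S))⁻¹ := by
        rw [ENNReal.mul_inv (Or.inl hq2) (Or.inl ENNReal.ofReal_ne_top), ← mul_assoc,
          show q ^ 3 = q * q ^ 2 by ring, ENNReal.ofReal_mul hq0.le, mul_assoc (ENNReal.ofReal q),
          ENNReal.mul_inv_cancel hq2 ENNReal.ofReal_ne_top, mul_one]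
    _ ≤ _ := by gcongr

/-- Here the cell must hold exactly one point, with probability `m e^(-m)` for length `m`. The
factor `e^(-m)` moves the void probability from `q ^ k` to `q ^ (k + 1)`, so the sum over `k` is a
right Riemann sum. -/
lemma IsPoissonPointProcess.le_lintegral_expNeg_ratio [IsProbabilityMeasure Pr]
    (h : IsPoissonPointProcess t Λ Pr) (hΛ : ∀ b, Λ (Set.Iio b) = ENNReal.ofReal b)
    (hψ : AntitoneOn ψ (Set.Ioi 0)) (hy : ∀ᵐ ω ∂Pr, ∀ m, t (y ω) ω ≤ t m ω) {q : ℝ} (hq : 1 < q) :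
    (1 + ∫⁻ u in Set.Ici 1, (1 - expNeg (ψ u)))⁻¹ ≤ ENNReal.ofReal (q ^ 3) *
      ∫⁻ ω, expNeg (∑' n, if n = y ω then 0 else ψ (t n ω / t (y ω) ω)) ∂Pr := by
  have hq0 : 0 < q := zero_lt_one.trans hq
  set S := ∑' i : ℕ, ENNReal.ofReal (q ^ (i + 2) - q ^ (i + 1)) * (1 - expNeg (ψ (q ^ i)))
    with hS
  have hpt : ∀ᵐ ω ∂Pr, ∑' k : ℤ, {ω | pointCount t (geomPartition q k 0) ω = 0 ∧
        pointCount t (geomPartition q k 1) ω = 1}.indicator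
      (fun ω => expNeg (∑' i, pointCount t (geomPartition q k (i + 2)) ω * ψ (q ^ i))) ω ≤
      expNeg (∑' n, if n = y ω then 0 else ψ (t n ω / t (y ω) ω)) := by
    filter_upwards [hy, h.ae_pos hΛ] with ω hω hpos
    obtain ⟨k, hk⟩ := exists_mem_Ico_zpow (hpos (y ω)) hq
    have hmono := (zpow_right_mono₀ hq.le).pairwise_disjoint_on_Ico_succ
    simp only [Order.succ_eq_add_one] at hmono
    -- The events for distinct `k` are disjoint: each places the first point in its own cell.
    rw [tsum_eq_single k]
    · rw [← geomPartition_one] at hk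
      by_cases hD : ω ∈ {ω | pointCount t (geomPartition q k 0) ω = 0 ∧
        pointCount t (geomPartition q k 1) ω = 1}
      · rw [Set.indicator_of_mem hD]
        exact expNeg_antitone (tsum_le_tsum_pointCount_mul hq hψ hk hD.1 hD.2)
      · rw [Set.indicator_of_notMem hD]
        exact zero_le
    · intro l hl
      refine Set.indicator_of_notMem (fun hD => ?_) _
      have hm := mem_geomPartition_one_of_pointCount hω hD.1 (by rw [hD.2]; exact one_ne_zero)
      rw [geomPartition_one] at hm
      exact Set.disjoint_left.1 (hmono hl) hm hk
  have hle := lintegral_mono_ae hpt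
  rw [lintegral_tsum fun k => (measurable_expNeg_tsum_pointCount h q k (· = 1) _).aemeasurable]
    at hle
  have hterm : ∀ k : ℤ, ENNReal.ofReal (q ^ (k + 1) - q ^ k) *
        expNeg (ENNReal.ofReal (q ^ (k + 1)) * (1 + S)) ≤
      ∫⁻ ω, {ω | pointCount t (geomPartition q k 0) ω = 0 ∧
        pointCount t (geomPartition q k 1) ω = 1}.indicator
      (fun ω => expNeg (∑' i, pointCount t (geomPartition q k (i + 2)) ω * ψ (q ^ i))) ω ∂Pr := by
    intro k
    have hk := (zpow_pos hq0 k).le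
    have hkk : q ^ k ≤ q ^ (k + 1) := zpow_le_zpow_right₀ hq.le (by omega)
    have hone : Λ (geomPartition q k 1) = ENNReal.ofReal (q ^ (k + 1) - q ^ k) := by
      rw [geomPartition_one, measure_Ico_of_measure_Iio hΛ hk hkk]
    rw [h.lintegral_indicator_expNeg_tsum (measurableSet_geomPartition q k)
      (pairwise_disjoint_geomPartition hq k) (measure_geomPartition_ne_top hΛ hq k) (· = 1),
      h.measure_eq_one (measurableSet_geomPartition q k 1) (measure_geomPartition_ne_top hΛ hq k 1),
      tsum_measure_geomPartition hΛ hq, mul_add, expNeg_add, mul_one, ← hS,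
      show Λ (geomPartition q k 0) = ENNReal.ofReal (q ^ k) from hΛ _]
    have hexp : expNeg (ENNReal.ofReal (q ^ (k + 1))) =
        expNeg (ENNReal.ofReal (q ^ k)) * expNeg (Λ (geomPartition q k 1)) := by
      rw [← expNeg_add, hone, ← ENNReal.ofReal_add hk (sub_nonneg.2 hkk), add_sub_cancel]
    calc _ = expNeg (ENNReal.ofReal (q ^ k)) * (expNeg (Λ (geomPartition q k 1)) *
          Λ (geomPartition q k 1)) * expNeg (ENNReal.ofReal (q ^ (k + 1)) * S) := by
          rw [hexp, hone]; ring
      _ ≤ _ := by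
          gcongr
          exact expNeg_antitone (by gcongr)
  have hsum := (ENNReal.tsum_le_tsum hterm).trans hle
  have hint := lintegral_Ioi_le_tsum_zpow_mul hq ((antitone_expNeg_ofReal_mul (1 + S)).antitoneOn _)
  rw [lintegral_Ioi_expNeg_mul (by simp)] at hint
  have hH := one_add_tsum_le hq (antitoneOn_one_sub_expNeg hψ) fun _ => tsub_le_self
  rw [← hS] at hH
  have hq2 : ENNReal.ofReal (q ^ 2) ≠ 0 := by simpa using hq0.ne'
  set H := 1 + ∫⁻ u in Set.Ici 1, (1 - expNeg (ψ u))
  calc H⁻¹ = ENNReal.ofReal (q ^ 2) * (ENNReal.ofReal (q ^ 2) * H)⁻¹ := by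
        rw [ENNReal.mul_inv (Or.inl hq2) (Or.inl ENNReal.ofReal_ne_top), ← mul_assoc,
          ENNReal.mul_inv_cancel hq2 ENNReal.ofReal_ne_top, one_mul]
    _ ≤ ENNReal.ofReal (q ^ 2) * (1 + S)⁻¹ := by gcongr
    _ ≤ ENNReal.ofReal (q ^ 2) * (ENNReal.ofReal q * ∫⁻ ω,
        expNeg (∑' n, if n = y ω then 0 else ψ (t n ω / t (y ω) ω)) ∂Pr) := by
        gcongr
        exact hint.trans (mul_le_mul_right hsum _)
    _ = _ := by
        rw [← mul_assoc, ← ENNReal.ofReal_mul (by positivity), show q ^ 2 * q = q ^ 3 by ring]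

/-- Laplace functional of a unit rate Poisson process on the half line, seen from its first point:
the other points are weighted according to their ratio to the first one. -/
lemma IsPoissonPointProcess.lintegral_expNeg_ratio [IsProbabilityMeasure Pr]
    (h : IsPoissonPointProcess t Λ Pr) (hΛ : ∀ b, Λ (Set.Iio b) = ENNReal.ofReal b)
    (hψ : AntitoneOn ψ (Set.Ioi 0)) (hy : ∀ᵐ ω ∂Pr, ∀ m, t (y ω) ω ≤ t m ω) :
    ∫⁻ ω, expNeg (∑' n, if n = y ω then 0 else ψ (t n ω / t (y ω) ω)) ∂Pr =
      (1 + ∫⁻ u in Set.Ici 1, (1 - expNeg (ψ u)))⁻¹ := by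
  have hlim : ∀ a : ℝ≥0∞, Tendsto (fun q : ℝ => ENNReal.ofReal (q ^ 3) * a) (𝓝[>] 1) (𝓝 a) := by
    intro a
    have h1 : Tendsto (fun q : ℝ => ENNReal.ofReal (q ^ 3)) (𝓝[>] 1) (𝓝 1) := by
      have hc : Continuous fun q : ℝ => ENNReal.ofReal (q ^ 3) :=
        ENNReal.continuous_ofReal.comp (continuous_pow 3)
      simpa using (hc.tendsto 1).mono_left nhdsWithin_le_nhds
    simpa using ENNReal.Tendsto.mul_const h1 (Or.inl one_ne_zero)
  refine le_antisymm (ge_of_tendsto (hlim _) ?_) (ge_of_tendsto (hlim _) ?_)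
  · filter_upwards [self_mem_nhdsWithin] with q hq
    exact h.lintegral_expNeg_ratio_le hΛ hψ hy hq
  · filter_upwards [self_mem_nhdsWithin] with q hq
    exact h.le_lintegral_expNeg_ratio hΛ hψ hy hq

end UnitRate

/-! ### Exponential fading and the law of a mark. -/

section Exponential

variable {r : ℝ}

lemma expMeasure_Ioi (hr : 0 < r) {s : ℝ} (hs : 0 ≤ s) :
    expMeasure r (Set.Ioi s) = ENNReal.ofReal (Real.exp (-(r * s))) := by
  have := isProbabilityMeasure_expMeasure hr
  have h := cdf_expMeasure_eq hr s
  rw [cdf_eq_real, if_pos hs] at h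
  rw [← Set.compl_Iic, ← ofReal_measureReal, probReal_compl_eq_one_sub measurableSet_Iic, h,
    sub_sub_cancel]

lemma expMeasure_ofReal_gt (hr : 0 < r) (c : ℝ≥0∞) :
    expMeasure r {x | c < ENNReal.ofReal x} = expNeg (ENNReal.ofReal r * c) := by
  rcases eq_or_ne c ⊤ with rfl | hc
  · rw [ENNReal.mul_top (by simpa using hr), expNeg_top]
    simp
  · have hs : (0 : ℝ) ≤ c.toReal := ENNReal.toReal_nonneg
    have hset : {x | c < ENNReal.ofReal x} = Set.Ioi c.toReal := by
      ext x
      exact ENNReal.lt_ofReal_iff_toReal_lt hc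
    rw [hset, expMeasure_Ioi hr hs, ← expNeg_ofReal (by positivity), ENNReal.ofReal_mul hr.le,
      ENNReal.ofReal_toReal hc]

lemma expMeasure_ofReal_ge (hr : 0 < r) (c : ℝ≥0∞) :
    expMeasure r {x | c ≤ ENNReal.ofReal x} = expNeg (ENNReal.ofReal r * c) := by
  have := isProbabilityMeasure_expMeasure hr
  -- Zero is separate because `ENNReal.ofReal` sends every nonpositive `x` to `0`; for other `c`,
  -- equality happens at a single point, which is null.
  rcases eq_or_ne c 0 with rfl | h0
  · simp
  rw [← expMeasure_ofReal_gt hr]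
  refine measure_congr ?_
  have hac : expMeasure r ≪ volume := withDensity_absolutelyContinuous _ _
  have hne : ∀ᵐ x ∂(expMeasure r), x ≠ c.toReal :=
    hac.ae_le (Measure.ae_ne volume c.toReal)
  filter_upwards [hne] with x hx
  refine propext ⟨fun h => lt_of_le_of_ne h fun h' => hx ?_, fun h => le_of_lt h⟩
  have hx0 : 0 < x := ENNReal.ofReal_pos.1 (by rw [← h']; exact pos_iff_ne_zero.2 h0)
  rw [h', ENNReal.toReal_ofReal hx0.le]

/-- The weight tilts the density of rate `r` into `1 / (1 + A)` times the density of rate `r * (1 +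
A)`. -/
lemma lintegral_expNeg_expMeasure (hr : 0 < r) {A : ℝ} (hA : 0 ≤ A) :
    ∫⁻ x, expNeg (ENNReal.ofReal r * ENNReal.ofReal (x * A)) ∂(expMeasure r) =
      ENNReal.ofReal (1 / (1 + A)) := by
  have hr' : 0 < r * (1 + A) := by positivity
  have hm : Measurable (exponentialPDF r) :=
    (measurable_exponentialPDFReal r).ennreal_ofReal
  have hm' : Measurable fun x => expNeg (ENNReal.ofReal r * ENNReal.ofReal (x * A)) :=
    measurable_expNeg.comp (by fun_prop)
  have hd : expMeasure r = volume.withDensity (exponentialPDF r) := rfl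
  rw [hd, lintegral_withDensity_eq_lintegral_mul _ hm hm']
  have hpt : ∀ x, (exponentialPDF r * fun x => expNeg (ENNReal.ofReal r * ENNReal.ofReal (x * A))) x
      = ENNReal.ofReal (1 / (1 + A)) * exponentialPDF (r * (1 + A)) x := by
    intro x
    rw [Pi.mul_apply]
    rcases lt_or_ge x 0 with hx | hx
    · simp [exponentialPDF_of_neg hx]
    · rw [exponentialPDF_of_nonneg hx, exponentialPDF_of_nonneg hx, ← ENNReal.ofReal_mul hr.le,
        expNeg_ofReal (by positivity), ← ENNReal.ofReal_mul (by positivity),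
        ← ENNReal.ofReal_mul (by positivity), mul_assoc r, ← Real.exp_add]
      congr 1
      rw [show -(r * x) + -(r * (x * A)) = -(r * (1 + A) * x) by ring]
      field_simp
  simp_rw [hpt]
  rw [lintegral_const_mul' _ _ ENNReal.ofReal_ne_top,
    lintegral_exponentialPDF_eq_one hr', mul_one]

end Exponential

lemma lintegral_uniformOn_univ {Δ : ℕ} (f : Fin Δ → ℝ≥0∞) :
    ∫⁻ d, f d ∂(uniformOn (Set.univ : Set (Fin Δ))) = (Δ : ℝ≥0∞)⁻¹ * ∑ d, f d := by
  rw [uniformOn, ProbabilityTheory.cond, Measure.restrict_univ, lintegral_smul_measure,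
    lintegral_count, tsum_fintype, Measure.count_univ, smul_eq_mul]
  simp

lemma lintegral_mark_law {r : ℝ} (hr : 0 < r) {Δ : ℕ} {u : ℝ → ℝ≥0∞} {v : Fin Δ → ℝ → ℝ≥0∞}
    (hu : Measurable u) (hv : ∀ d, Measurable (v d)) :
    ∫⁻ m, u m.1 * v m.2.2 m.2.1 ∂((expMeasure r).prod ((expMeasure r).prod
        (uniformOn (Set.univ : Set (Fin Δ))))) =
      (∫⁻ a, u a ∂(expMeasure r)) * ((Δ : ℝ≥0∞)⁻¹ * ∑ d, ∫⁻ b, v d b ∂(expMeasure r)) := by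
  have := isProbabilityMeasure_expMeasure hr
  have hv' : Measurable fun p : ℝ × Fin Δ => v p.2 p.1 := measurable_from_prod_countable_left hv
  rw [lintegral_prod_mul (f := u) (g := fun p : ℝ × Fin Δ => v p.2 p.1) hu.aemeasurable
    hv'.aemeasurable, lintegral_prod_symm _ hv'.aemeasurable, lintegral_uniformOn_univ]

/-- Separates the mark of the server from all the interfering marks jointly, through σ-algebras
generated by disjoint index sets. -/
lemma ProbabilityTheory.iIndepFun.indepFun_compl_singleton {Ω ι β : Type*} [MeasurableSpace Ω]
    [MeasurableSpace β] {Pr : Measure Ω} {M : ι → Ω → β} (hM : ∀ n, Measurable (M n))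
    (h : iIndepFun M Pr) (y : ι) :
    IndepFun (M y) (fun ω (n : {n // n ≠ y}) => M n ω) Pr := by
  rw [iIndepFun_iff_iIndep] at h
  have hd := indep_iSup_of_disjoint (S := {y}) (T := {y}ᶜ) (fun n => (hM n).comap_le) h
    disjoint_compl_right
  rw [IndepFun_iff_Indep]
  refine indep_of_indep_of_le_left (indep_of_indep_of_le_right hd ?_) ?_
  · rw [MeasurableSpace.pi, MeasurableSpace.comap_iSup]
    refine iSup_le fun n => ?_
    rw [MeasurableSpace.comap_comp]
    exact le_iSup₂_of_le (n : ι) n.2 le_rfl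
  · exact le_iSup₂_of_le y rfl le_rfl

/-! ### Averaging over the marks for fixed locations. -/

/-- The conditional mean contribution of a single interferer, where `a` and `b` are its normalized
powers on the common and on the reserved sub-bands. -/
noncomputable def edgeFactor (Δ : ℕ) (a b : ℝ) : ℝ :=
  1 / (1 + a) * (1 - 1 / (Δ : ℝ) * (1 - 1 / (1 + b)))

section EdgeFactor

variable {Δ : ℕ} {a b : ℝ}

lemma one_sub_div_bounds (hΔ : 1 ≤ Δ) (hb : 0 ≤ b) :
    0 < 1 - 1 / (Δ : ℝ) * (1 - 1 / (1 + b)) ∧ 1 - 1 / (Δ : ℝ) * (1 - 1 / (1 + b)) ≤ 1 := by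
  have hΔ' : (1 : ℝ) ≤ Δ := by exact_mod_cast hΔ
  have h1 : 0 < 1 / (1 + b) := by positivity
  have h2 : 1 / (1 + b) ≤ 1 := by rw [div_le_one (by positivity)]; linarith
  have h3 : 0 < 1 / (Δ : ℝ) := by positivity
  have h4 : 1 / (Δ : ℝ) ≤ 1 := by rw [div_le_one (by positivity)]; exact hΔ'
  constructor <;> nlinarith

lemma edgeFactor_pos (hΔ : 1 ≤ Δ) (ha : 0 ≤ a) (hb : 0 ≤ b) : 0 < edgeFactor Δ a b :=
  mul_pos (by positivity) (one_sub_div_bounds hΔ hb).1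

lemma edgeFactor_le_one (hΔ : 1 ≤ Δ) (ha : 0 ≤ a) (hb : 0 ≤ b) : edgeFactor Δ a b ≤ 1 := by
  refine mul_le_one₀ ?_ (one_sub_div_bounds hΔ hb).1.le (one_sub_div_bounds hΔ hb).2
  rw [div_le_one (by positivity)]; linarith

lemma edgeFactor_anti (hΔ : 1 ≤ Δ) {a' b' : ℝ} (ha : 0 ≤ a) (hb : 0 ≤ b) (haa : a ≤ a')
    (hbb : b ≤ b') : edgeFactor Δ a' b' ≤ edgeFactor Δ a b := by
  refine mul_le_mul (by gcongr) ?_ (one_sub_div_bounds hΔ (hb.trans hbb)).1.le (by positivity)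
  gcongr

end EdgeFactor

section Marks

variable {Ω : Type*} [MeasurableSpace Ω] {Pr : Measure Ω} {Δ : ℕ}
  {M : ℕ → Ω → ℝ × ℝ × Fin Δ} {r : ℝ}

/-- Common fading contributes `1 / (1 + a)`. The reserved one contributes `1 / (1 + b)` when the
interferer is on the server's sub-band `d`, which has probability `1 / Δ`, and `1` otherwise. -/
lemma lintegral_expNeg_mark (hr : 0 < r) (hΔ : 1 ≤ Δ) {a b : ℝ} (ha : 0 ≤ a) (hb : 0 ≤ b)
    (d : Fin Δ) :
    ∫⁻ m, expNeg (ENNReal.ofReal r * (ENNReal.ofReal (m.1 * a) +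
        if m.2.2 = d then ENNReal.ofReal (m.2.1 * b) else 0))
      ∂((expMeasure r).prod ((expMeasure r).prod (uniformOn (Set.univ : Set (Fin Δ))))) =
      ENNReal.ofReal (edgeFactor Δ a b) := by
  have := isProbabilityMeasure_expMeasure hr
  have hmu : ∀ c : ℝ, Measurable fun x : ℝ => expNeg (ENNReal.ofReal r * ENNReal.ofReal (x * c)) :=
    fun c => measurable_expNeg.comp (by fun_prop)
  have hsplit : ∀ m : ℝ × ℝ × Fin Δ, expNeg (ENNReal.ofReal r * (ENNReal.ofReal (m.1 * a) +
        if m.2.2 = d then ENNReal.ofReal (m.2.1 * b) else 0)) =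
      expNeg (ENNReal.ofReal r * ENNReal.ofReal (m.1 * a)) *
        (fun e x => if e = d then expNeg (ENNReal.ofReal r * ENNReal.ofReal (x * b)) else 1)
          m.2.2 m.2.1 := by
    intro m
    rw [mul_add, expNeg_add]
    by_cases h : m.2.2 = d <;> simp [h]
  simp_rw [hsplit]
  rw [lintegral_mark_law hr (hmu a)
    (v := fun e x => if e = d then expNeg (ENNReal.ofReal r * ENNReal.ofReal (x * b)) else 1)
    (fun e => by by_cases h : e = d <;> simp [h, hmu b]), lintegral_expNeg_expMeasure hr ha]
  have hterm : ∀ e : Fin Δ, ∫⁻ x, (if e = d then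
      expNeg (ENNReal.ofReal r * ENNReal.ofReal (x * b)) else 1) ∂(expMeasure r) =
      ENNReal.ofReal (1 - if e = d then 1 - 1 / (1 + b) else 0) := by
    intro e
    by_cases h : e = d
    · simp only [h, if_true]
      rw [lintegral_expNeg_expMeasure hr hb, sub_sub_cancel]
    · simp [h]
  have hΔ0 : (0 : ℝ) < Δ := by exact_mod_cast hΔ
  simp_rw [hterm]
  rw [← ENNReal.ofReal_sum_of_nonneg, Finset.sum_sub_distrib, Finset.sum_ite_eq' Finset.univ d,
    ← ENNReal.ofReal_natCast Δ, ← ENNReal.ofReal_inv_of_pos hΔ0,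
    ← ENNReal.ofReal_mul (by positivity), ← ENNReal.ofReal_mul (by positivity), edgeFactor]
  · congr 2
    simp only [Finset.sum_const, Finset.card_univ, Fintype.card_fin, nsmul_eq_mul, mul_one,
      Finset.mem_univ, if_true]
    field_simp
  · intro e _
    split_ifs
    · rw [sub_sub_cancel]; positivity
    · simp

/-- Conditional coverage probability given the locations of the base stations: `A n` and `B n` are
the normalized powers received from base station `n` on the two sub-bands. -/
lemma measure_coverage [IsProbabilityMeasure Pr] (hr : 0 < r) (hΔ : 1 ≤ Δ)
    (hM : ∀ n, Measurable (M n))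
    (hlaw : ∀ n, HasLaw (M n) ((expMeasure r).prod ((expMeasure r).prod
      (uniformOn (Set.univ : Set (Fin Δ))))) Pr)
    (hind : iIndepFun M Pr) (y : ℕ) {A B : ℕ → ℝ} (hA : ∀ n, 0 ≤ A n) (hB : ∀ n, 0 ≤ B n) :
    Pr {ω | (∑' n, if n = y then 0 else ENNReal.ofReal ((M n ω).1 * A n)) ≤
          ENNReal.ofReal (M y ω).1 ∧
        (∑' n, if n = y then 0 else if (M n ω).2.2 = (M y ω).2.2 then
          ENNReal.ofReal ((M n ω).2.1 * B n) else 0) < ENNReal.ofReal (M y ω).2.1} =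
      expNeg (∑' n, if n = y then 0 else ENNReal.ofReal (-Real.log (edgeFactor Δ (A n) (B n)))) := by
  have := isProbabilityMeasure_expMeasure hr
  set law := (expMeasure r).prod ((expMeasure r).prod (uniformOn (Set.univ : Set (Fin Δ))))
  -- The index `y` is removed so that `V` is independent of `M y`.
  let V : Ω → {n // n ≠ y} → ℝ × ℝ × Fin Δ := fun ω n => M n ω
  have hV : Measurable V := measurable_pi_lambda _ fun n => hM n
  let I : ({n // n ≠ y} → ℝ × ℝ × Fin Δ) → ℝ≥0∞ := fun v =>
    ∑' n, if h : n = y then 0 else ENNReal.ofReal ((v ⟨n, h⟩).1 * A n)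
  let J : Fin Δ → ({n // n ≠ y} → ℝ × ℝ × Fin Δ) → ℝ≥0∞ := fun d v =>
    ∑' n, if h : n = y then 0 else
      if (v ⟨n, h⟩).2.2 = d then ENNReal.ofReal ((v ⟨n, h⟩).2.1 * B n) else 0
  have hI : Measurable I := by
    refine Measurable.tsum fun n => ?_
    by_cases h : n = y
    · simp [h]
    · simp only [h, dite_false]
      fun_prop
  have hJ : ∀ d, Measurable (J d) := by
    intro d
    refine Measurable.tsum fun n => ?_
    by_cases h : n = y
    · simp [h]
    · simp only [h, dite_false]
      refine Measurable.ite ?_ (by fun_prop) measurable_const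
      have hm : Measurable fun v : {n // n ≠ y} → ℝ × ℝ × Fin Δ => (v ⟨n, h⟩).2.2 := by fun_prop
      exact hm (measurableSet_singleton d)
  have hJ' : Measurable fun p : (ℝ × ℝ × Fin Δ) × ({n // n ≠ y} → ℝ × ℝ × Fin Δ) =>
      J p.1.2.2 p.2 := by
    have h1 : Measurable fun p : Fin Δ × ({n // n ≠ y} → ℝ × ℝ × Fin Δ) => J p.1 p.2 :=
      measurable_from_prod_countable_right hJ
    exact h1.comp (by fun_prop : Measurable fun p : (ℝ × ℝ × Fin Δ) ×
      ({n // n ≠ y} → ℝ × ℝ × Fin Δ) => (p.1.2.2, p.2))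
  have hS : MeasurableSet {p : (ℝ × ℝ × Fin Δ) × ({n // n ≠ y} → ℝ × ℝ × Fin Δ) |
      I p.2 ≤ ENNReal.ofReal p.1.1 ∧ J p.1.2.2 p.2 < ENNReal.ofReal p.1.2.1} :=
    (measurableSet_le (hI.comp measurable_snd) (by fun_prop)).inter
      (measurableSet_lt hJ' (by fun_prop))
  -- With the other marks frozen, the two fadings of the server are independent and their
  -- exponential tails multiply.
  have hcondlaw : ∀ v, law {m | I v ≤ ENNReal.ofReal m.1 ∧ J m.2.2 v < ENNReal.ofReal m.2.1} =
      (Δ : ℝ≥0∞)⁻¹ * ∑ d, expNeg (ENNReal.ofReal r * (I v + J d v)) := by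
    intro v
    have hmI : MeasurableSet {a : ℝ | I v ≤ ENNReal.ofReal a} :=
      measurableSet_le measurable_const ENNReal.measurable_ofReal
    have hmJ : ∀ d, MeasurableSet {b : ℝ | J d v < ENNReal.ofReal b} := fun d =>
      measurableSet_lt measurable_const ENNReal.measurable_ofReal
    have h1 := lintegral_mark_law hr (measurable_one.indicator hmI)
      (v := fun d => {b : ℝ | J d v < ENNReal.ofReal b}.indicator 1)
      (fun d => measurable_one.indicator (hmJ d))
    simp_rw [lintegral_indicator_one hmI, fun d => lintegral_indicator_one (μ := expMeasure r)
      (hmJ d), expMeasure_ofReal_ge hr, expMeasure_ofReal_gt hr] at h1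
    have hmS : MeasurableSet {m : ℝ × ℝ × Fin Δ |
        I v ≤ ENNReal.ofReal m.1 ∧ J m.2.2 v < ENNReal.ofReal m.2.1} :=
      measurable_prodMk_right hS
    simp_rw [mul_add, expNeg_add, ← Finset.mul_sum]
    rw [mul_left_comm, ← h1, ← lintegral_indicator_one hmS]
    refine lintegral_congr fun m => ?_
    by_cases ha : I v ≤ ENNReal.ofReal m.1 <;> by_cases hb : J m.2.2 v < ENNReal.ofReal m.2.1 <;>
      simp [Set.indicator, ha, hb]
  have hmap : Pr.map (fun ω => (M y ω, V ω)) = law.prod (Pr.map V) := by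
    rw [(indepFun_iff_map_prod_eq_prod_map_map (hM y).aemeasurable hV.aemeasurable).1
      (hind.indepFun_compl_singleton hM y), (hlaw y).map_eq]
  have : IsProbabilityMeasure (Pr.map V) := Measure.isProbabilityMeasure_map hV.aemeasurable
  have hevent : {ω | (∑' n, if n = y then 0 else ENNReal.ofReal ((M n ω).1 * A n)) ≤
          ENNReal.ofReal (M y ω).1 ∧
        (∑' n, if n = y then 0 else if (M n ω).2.2 = (M y ω).2.2 then
          ENNReal.ofReal ((M n ω).2.1 * B n) else 0) < ENNReal.ofReal (M y ω).2.1} =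
      (fun ω => (M y ω, V ω)) ⁻¹' {p | I p.2 ≤ ENNReal.ofReal p.1.1 ∧
        J p.1.2.2 p.2 < ENNReal.ofReal p.1.2.1} := by
    ext ω
    simp [I, J, V]
  have : IsProbabilityMeasure law := by
    rw [← (hlaw y).map_eq]; exact Measure.isProbabilityMeasure_map (hM y).aemeasurable
  rw [hevent, ← Measure.map_apply ((hM y).prodMk hV) hS, hmap, Measure.prod_apply_symm hS]
  have hpre : ∀ v, (fun m => (m, v)) ⁻¹' {p : (ℝ × ℝ × Fin Δ) × ({n // n ≠ y} → ℝ × ℝ × Fin Δ) |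
      I p.2 ≤ ENNReal.ofReal p.1.1 ∧ J p.1.2.2 p.2 < ENNReal.ofReal p.1.2.1} =
      {m | I v ≤ ENNReal.ofReal m.1 ∧ J m.2.2 v < ENNReal.ofReal m.2.1} := fun v => rfl
  simp_rw [hpre, hcondlaw]
  have hΔ0 : (Δ : ℝ≥0∞) ≠ 0 := by exact_mod_cast (by omega : Δ ≠ 0)
  have hmE : ∀ d, Measurable fun v => expNeg (ENNReal.ofReal r * (I v + J d v)) := fun d =>
    measurable_expNeg.comp ((hI.add (hJ d)).const_mul _)
  have hmEV : ∀ d, Measurable fun ω => expNeg (ENNReal.ofReal r * (I (V ω) + J d (V ω))) :=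
    fun d => (hmE d).comp hV
  rw [lintegral_map ((Finset.measurable_sum _ fun d _ => hmE d).const_mul _) hV,
    lintegral_const_mul' _ _ (ENNReal.inv_ne_top.2 hΔ0),
    lintegral_finsetSum _ fun d _ => hmEV d]
  -- The value does not depend on `d`, so the average over the server's sub-band is trivial.
  have hd : ∀ d, ∫⁻ ω, expNeg (ENNReal.ofReal r * (I (V ω) + J d (V ω))) ∂Pr =
      expNeg (∑' n, if n = y then 0 else
        ENNReal.ofReal (-Real.log (edgeFactor Δ (A n) (B n)))) := by
    intro d
    let F : ℕ → ℝ × ℝ × Fin Δ → ℝ≥0∞ := fun n m => if n = y then 0 else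
      ENNReal.ofReal r * (ENNReal.ofReal (m.1 * A n) +
        if m.2.2 = d then ENNReal.ofReal (m.2.1 * B n) else 0)
    have hF : ∀ n, Measurable (F n) := by
      intro n
      by_cases h : n = y
      · simp [F, h]
      · simp only [F, h, if_false]
        have hm : MeasurableSet {m : ℝ × ℝ × Fin Δ | m.2.2 = d} :=
          (by fun_prop : Measurable fun m : ℝ × ℝ × Fin Δ => m.2.2) (measurableSet_singleton d)
        have ha : Measurable fun m : ℝ × ℝ × Fin Δ => ENNReal.ofReal (m.1 * A n) := by fun_prop
        have hb : Measurable fun m : ℝ × ℝ × Fin Δ => ENNReal.ofReal (m.2.1 * B n) := by fun_prop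
        exact (ha.add (Measurable.ite hm hb measurable_const)).const_mul _
    have hsum : ∀ ω, ENNReal.ofReal r * (I (V ω) + J d (V ω)) = ∑' n, F n (M n ω) := by
      intro ω
      simp only [I, J, V, F]
      rw [← ENNReal.tsum_add, ← ENNReal.tsum_mul_left]
      congr 1 with n
      by_cases h : n = y <;> simp [h]
    simp_rw [hsum]
    refine lintegral_expNeg_tsum (X := fun n ω => F n (M n ω)) (fun n => (hF n).comp (hM n))
      (fun N => ((hind.precomp Fin.val_injective).comp (fun i : Fin N => F i) fun i => hF i)) ?_
    intro n
    rw [← lintegral_map (f := fun m => expNeg (F n m)) (measurable_expNeg.comp (hF n)) (hM n),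
      (hlaw n).map_eq]
    by_cases h : n = y
    · simp [F, h]
    · simp only [F, h, if_false]
      rw [lintegral_expNeg_mark hr hΔ (hA n) (hB n) d, expNeg_ofReal_neg_log
        (edgeFactor_pos hΔ (hA n) (hB n)) (edgeFactor_le_one hΔ (hA n) (hB n))]
  simp_rw [hd]
  rw [Finset.sum_const, Finset.card_univ, Fintype.card_fin, nsmul_eq_mul, ← mul_assoc,
    ENNReal.inv_mul_cancel hΔ0 (by simp), one_mul]

end Marks

/-! ### Integrals for path loss exponent four. -/

/-- `∫_1^∞ a / (u² + a) du` in closed form. -/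
noncomputable def rhoClosed (a : ℝ) : ℝ := √a * (Real.pi / 2 - Real.arctan (1 / √a))

lemma rhoClosed_zero : rhoClosed 0 = 0 := by simp [rhoClosed]

lemma hasDerivAt_sqrt_mul_arctan {a : ℝ} (ha : 0 < a) (u : ℝ) :
    HasDerivAt (fun u => √a * Real.arctan (u / √a)) (a / (u ^ 2 + a)) u := by
  have hs := Real.sqrt_pos.2 ha
  have h := (((hasDerivAt_id u).div_const √a).arctan).const_mul √a
  have hsq : √a ^ 2 = a := Real.sq_sqrt ha.le
  convert! h using 1
  rw [id, div_pow, hsq]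
  field_simp
  ring

lemma tendsto_sqrt_mul_arctan {a : ℝ} (ha : 0 < a) :
    Tendsto (fun u => √a * Real.arctan (u / √a)) atTop (𝓝 (√a * (Real.pi / 2))) := by
  have h : Tendsto (fun u : ℝ => u / √a) atTop atTop :=
    tendsto_id.atTop_div_const (Real.sqrt_pos.2 ha)
  exact (((Real.tendsto_arctan_atTop.mono_right nhdsWithin_le_nhds).comp h)).const_mul _

lemma integrableOn_div_sq_add {a : ℝ} (ha : 0 ≤ a) :
    IntegrableOn (fun u : ℝ => a / (u ^ 2 + a)) (Set.Ioi 1) := by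
  rcases ha.eq_or_lt with rfl | ha
  · simp
  · exact integrableOn_Ioi_deriv_of_nonneg' (fun u _ => hasDerivAt_sqrt_mul_arctan ha u)
      (fun u _ => by positivity) (tendsto_sqrt_mul_arctan ha)

lemma integral_div_sq_add {a : ℝ} (ha : 0 ≤ a) :
    ∫ u in Set.Ioi (1 : ℝ), a / (u ^ 2 + a) = rhoClosed a := by
  rcases ha.eq_or_lt with rfl | ha
  · simp [rhoClosed_zero]
  · rw [integral_Ioi_of_hasDerivAt_of_nonneg' (fun u _ => hasDerivAt_sqrt_mul_arctan ha u)
      (fun u _ => by positivity) (tendsto_sqrt_mul_arctan ha), rhoClosed, mul_sub]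

/-- The confluent case `F = T` of the cross term; the antiderivative comes from integrating by parts
against the derivative of `-1 / (2 * (u ^ 2 + a))`. -/
lemma hasDerivAt_sq_div_sq {a : ℝ} (ha : 0 < a) (u : ℝ) :
    HasDerivAt (fun u => √a * Real.arctan (u / √a) / 2 - a * u / (2 * (u ^ 2 + a)))
      (a * u ^ 2 / ((u ^ 2 + a) * (u ^ 2 + a))) u := by
  have h0 : 2 * (u ^ 2 + a) ≠ 0 := by positivity
  have h1 := ((hasDerivAt_id u).const_mul a).fun_div
    ((((hasDerivAt_pow 2 u).add_const a)).const_mul 2) h0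
  convert! ((hasDerivAt_sqrt_mul_arctan ha u).div_const 2).fun_sub h1 using 1
  simp only [id]
  field_simp
  ring

lemma tendsto_sq_div_sq {a : ℝ} (ha : 0 < a) :
    Tendsto (fun u => √a * Real.arctan (u / √a) / 2 - a * u / (2 * (u ^ 2 + a))) atTop
      (𝓝 (√a * (Real.pi / 2) / 2)) := by
  have h : Tendsto (fun u : ℝ => a * u / (2 * (u ^ 2 + a))) atTop (𝓝 0) := by
    have hlim : Tendsto (fun u : ℝ => a / 2 * u⁻¹) atTop (𝓝 0) := by
      simpa using tendsto_inv_atTop_zero.const_mul (a / 2)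
    refine squeeze_zero' ?_ ?_ hlim
    · filter_upwards [eventually_gt_atTop 0] with u hu
      positivity
    · filter_upwards [eventually_gt_atTop 0] with u hu
      rw [← div_eq_mul_inv, div_div, div_le_div_iff₀ (by positivity) (by positivity)]
      nlinarith [mul_pos ha ha]
  simpa using ((tendsto_sqrt_mul_arctan ha).div_const 2).sub h

lemma integrableOn_sq_div_sq {a : ℝ} (ha : 0 < a) :
    IntegrableOn (fun u : ℝ => a * u ^ 2 / ((u ^ 2 + a) * (u ^ 2 + a))) (Set.Ioi 1) :=
  integrableOn_Ioi_deriv_of_nonneg' (fun u _ => hasDerivAt_sq_div_sq ha u)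
    (fun u _ => by positivity) (tendsto_sq_div_sq ha)

lemma integral_sq_div_sq {a : ℝ} (ha : 0 < a) :
    ∫ u in Set.Ioi (1 : ℝ), a * u ^ 2 / ((u ^ 2 + a) * (u ^ 2 + a)) =
      rhoClosed a / 2 + a / (2 * (1 + a)) := by
  rw [integral_Ioi_of_hasDerivAt_of_nonneg' (fun u _ => hasDerivAt_sq_div_sq ha u)
      (fun u _ => by positivity) (tendsto_sq_div_sq ha), rhoClosed]
  simp only [one_pow, mul_one]
  ring

/-- Partial fractions, using `F (u² + T) - T (u² + F) = (F - T) u²`. Zero parameters are allowed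
because the marginal probabilities need them. -/
lemma integrableOn_cross {F T : ℝ} (hF : 0 ≤ F) (hT : 0 ≤ T) (h : F ≠ T) :
    IntegrableOn (fun u : ℝ => T * u ^ 2 / ((u ^ 2 + F) * (u ^ 2 + T))) (Set.Ioi 1) ∧
      ∫ u in Set.Ioi (1 : ℝ), T * u ^ 2 / ((u ^ 2 + F) * (u ^ 2 + T)) =
        T / (F - T) * (rhoClosed F - rhoClosed T) := by
  have hFT : F - T ≠ 0 := sub_ne_zero.2 h
  have heq : Set.EqOn (fun u : ℝ => T / (F - T) * (F / (u ^ 2 + F) - T / (u ^ 2 + T)))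
      (fun u => T * u ^ 2 / ((u ^ 2 + F) * (u ^ 2 + T))) (Set.Ioi 1) := by
    intro u hu
    have hu0 : 0 < u := zero_lt_one.trans hu
    have h1 : u ^ 2 + F ≠ 0 := by positivity
    have h2 : u ^ 2 + T ≠ 0 := by positivity
    dsimp only
    field_simp
    ring
  constructor
  · have hi : IntegrableOn (fun u : ℝ => T / (F - T) * (F / (u ^ 2 + F) - T / (u ^ 2 + T)))
        (Set.Ioi 1) :=
      Integrable.const_mul ((integrableOn_div_sq_add hF).sub (integrableOn_div_sq_add hT)) _
    exact hi.congr_fun heq measurableSet_Ioi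
  · rw [← setIntegral_congr_fun measurableSet_Ioi heq, integral_const_mul,
      integral_sub (integrableOn_div_sq_add hF) (integrableOn_div_sq_add hT),
      integral_div_sq_add hF, integral_div_sq_add hT]

/-- The probability that an interferer at squared relative distance `u` is felt. -/
noncomputable def edgeLoss (Δ : ℕ) (F T u : ℝ) : ℝ :=
  1 - edgeFactor Δ (F * (u ^ 2)⁻¹) (T * (u ^ 2)⁻¹)

lemma edgeLoss_eq {Δ : ℕ} {F T u : ℝ} (hF : 0 ≤ F) (hT : 0 ≤ T) (hu : 0 < u) :
    edgeLoss Δ F T u =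
      F / (u ^ 2 + F) + 1 / (Δ : ℝ) * (T * u ^ 2 / ((u ^ 2 + F) * (u ^ 2 + T))) := by
  have h1 : u ^ 2 + F ≠ 0 := by positivity
  have h2 : u ^ 2 + T ≠ 0 := by positivity
  have e1 : 1 / (1 + F * (u ^ 2)⁻¹) = u ^ 2 / (u ^ 2 + F) := by field_simp
  have e2 : 1 / (1 + T * (u ^ 2)⁻¹) = u ^ 2 / (u ^ 2 + T) := by field_simp
  rw [edgeLoss, edgeFactor, e1, e2]
  generalize 1 / (Δ : ℝ) = c
  field_simp
  ring

lemma edgeLoss_eqOn (Δ : ℕ) {F T : ℝ} (hF : 0 ≤ F) (hT : 0 ≤ T) :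
    Set.EqOn (fun u => F / (u ^ 2 + F) + 1 / (Δ : ℝ) * (T * u ^ 2 / ((u ^ 2 + F) * (u ^ 2 + T))))
      (edgeLoss Δ F T) (Set.Ioi 1) :=
  fun _ hu => (edgeLoss_eq hF hT (zero_lt_one.trans hu)).symm

lemma integrableOn_edgeLoss (Δ : ℕ) {F T : ℝ} (hF : 0 ≤ F) (hT : 0 ≤ T) :
    IntegrableOn (edgeLoss Δ F T) (Set.Ioi 1) := by
  refine ((integrableOn_div_sq_add hF).add (Integrable.const_mul ?_ _)).congr_fun
    (edgeLoss_eqOn Δ hF hT) measurableSet_Ioi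
  rcases eq_or_ne F T with rfl | h
  · rcases hF.eq_or_lt with rfl | hF
    · simp
    · exact integrableOn_sq_div_sq hF
  · exact (integrableOn_cross hF hT h).1

lemma integral_edgeLoss_of_ne (Δ : ℕ) {F T : ℝ} (hF : 0 ≤ F) (hT : 0 ≤ T) (h : F ≠ T) :
    ∫ u in Set.Ioi 1, edgeLoss Δ F T u =
      rhoClosed F + 1 / (Δ : ℝ) * (T / (F - T) * (rhoClosed F - rhoClosed T)) := by
  rw [← setIntegral_congr_fun measurableSet_Ioi (edgeLoss_eqOn Δ hF hT),
    integral_add (integrableOn_div_sq_add hF) ((integrableOn_cross hF hT h).1.const_mul _),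
    integral_const_mul, integral_div_sq_add hF, (integrableOn_cross hF hT h).2]

lemma integral_edgeLoss_self (Δ : ℕ) {F : ℝ} (hF : 0 < F) :
    ∫ u in Set.Ioi 1, edgeLoss Δ F F u =
      rhoClosed F + 1 / (Δ : ℝ) * (rhoClosed F / 2 + F / (2 * (1 + F))) := by
  rw [← setIntegral_congr_fun measurableSet_Ioi (edgeLoss_eqOn Δ hF.le hF.le),
    integral_add (integrableOn_div_sq_add hF.le) ((integrableOn_sq_div_sq hF).const_mul _),
    integral_const_mul, integral_div_sq_add hF.le, integral_sq_div_sq hF]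

lemma rhoFFR_four {T : ℝ} (hT : 0 < T) : rhoFFR T 4 = rhoClosed T := by
  have e1 : T ^ ((2 : ℝ) / 4) = √T := by rw [Real.sqrt_eq_rpow]; norm_num
  have e2 : T ^ (-(2 : ℝ) / 4) = 1 / √T := by
    rw [neg_div, Real.rpow_neg hT.le, e1, one_div]
  rw [rhoFFR, e1, e2, rhoClosed, ← integral_Ioi_inv_one_add_sq]
  congr 2
  ext u
  rw [show (4 : ℝ) / 2 = (2 : ℕ) by norm_num, Real.rpow_natCast, one_div]

/-- Substitution `u = x²`, with `du = 2x dx`. -/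
lemma two_mul_xiFFR_four (Δ : ℕ) (T F : ℝ) :
    2 * xiFFR T F 4 Δ = ∫ u in Set.Ioi 1, edgeLoss Δ F T u := by
  have h := integral_comp_rpow_Ioi_of_pos' (g := edgeLoss Δ F T) (p := 2) two_pos
    (zero_le_one (α := ℝ))
  rw [Real.one_rpow] at h
  rw [← h, xiFFR, ← integral_const_mul]
  refine setIntegral_congr_fun measurableSet_Ioi fun x hx => ?_
  have hx0 : 0 < x := zero_lt_one.trans hx
  have e1 : x ^ (2 : ℝ) = x ^ 2 := by exact_mod_cast Real.rpow_natCast x 2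
  have e2 : x ^ (-4 : ℝ) = ((x ^ 2) ^ 2)⁻¹ := by
    rw [Real.rpow_neg hx0.le, ← pow_mul]
    congr 1
    exact_mod_cast Real.rpow_natCast x 4
  have e3 : x ^ ((2 : ℝ) - 1) = x := by norm_num
  simp only [edgeLoss, edgeFactor, e1, e2, e3, smul_eq_mul]
  ring

/-! ### The closed forms of `ξ` and their limit on the diagonal. -/

lemma rpow_three_halves {a : ℝ} (ha : 0 ≤ a) : a ^ (3 / 2 : ℝ) = a * √a := by
  rw [Real.sqrt_eq_rpow, ← Real.rpow_one_add' ha (by norm_num)]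
  norm_num

lemma two_mul_xiClosed {Δ : ℕ} (hΔ : 1 ≤ Δ) {T F : ℝ} (hT : 0 ≤ T) (hF : 0 ≤ F) (h : F ≠ T) :
    2 * xiClosed T F Δ =
      rhoClosed F + 1 / (Δ : ℝ) * (T / (F - T) * (rhoClosed F - rhoClosed T)) := by
  have hFT : F - T ≠ 0 := sub_ne_zero.2 h
  have hΔ0 : (Δ : ℝ) ≠ 0 := by exact_mod_cast (by omega : Δ ≠ 0)
  rw [xiClosed, rpow_three_halves hT, rpow_three_halves hF, rhoClosed, rhoClosed]
  generalize Real.arctan (1 / √T) = x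
  generalize Real.arctan (1 / √F) = w
  field_simp
  ring

lemma two_mul_xiClosedDiag {Δ : ℕ} (hΔ : 1 ≤ Δ) {F : ℝ} (hF : 0 < F) :
    2 * xiClosedDiag F Δ =
      rhoClosed F + 1 / (Δ : ℝ) * (rhoClosed F / 2 + F / (2 * (1 + F))) := by
  have hΔ0 : (Δ : ℝ) ≠ 0 := by exact_mod_cast (by omega : Δ ≠ 0)
  have hF1 : F + 1 ≠ 0 := by positivity
  rw [xiClosedDiag, rhoClosed, add_comm 1 F]
  generalize Real.arctan (1 / √F) = w
  field_simp
  ring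

lemma hasDerivAt_rhoClosed {a : ℝ} (ha : 0 < a) :
    HasDerivAt rhoClosed (rhoClosed a / (2 * a) + 1 / (2 * (1 + a))) a := by
  have hs := Real.sqrt_pos.2 ha
  have hsq : √a ^ 2 = a := Real.sq_sqrt ha.le
  have h1 := Real.hasDerivAt_sqrt ha.ne'
  have h2 := (((h1.fun_inv hs.ne').arctan).const_sub (Real.pi / 2))
  have h3 := h1.fun_mul h2
  have hfun : rhoClosed = fun y => √y * (Real.pi / 2 - Real.arctan (√y)⁻¹) := by
    ext y; rw [rhoClosed, one_div]
  rw [hfun]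
  convert! h3 using 1
  dsimp only
  generalize Real.arctan (√a)⁻¹ = w
  rw [show (1 : ℝ) / (2 * (1 + a)) = 1 / (2 * (1 + √a ^ 2)) by rw [hsq],
    show √a * (Real.pi / 2 - w) / (2 * a) = √a * (Real.pi / 2 - w) / (2 * √a ^ 2) by rw [hsq]]
  field_simp
  ring

/-- Off the diagonal, the closed form contains the slope of `rhoClosed` between `F` and `t`, which
tends to the derivative at `F`. -/
lemma tendsto_xiClosed {Δ : ℕ} (hΔ : 1 ≤ Δ) {F : ℝ} (hF : 0 < F) :
    Tendsto (fun t => xiClosed t F Δ) (𝓝[≠] F) (𝓝 (xiClosedDiag F Δ)) := by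
  have hs := (hasDerivAt_iff_tendsto_slope.1 (hasDerivAt_rhoClosed hF))
  have hid : Tendsto (fun t : ℝ => t) (𝓝[≠] F) (𝓝 F) := nhdsWithin_le_nhds
  have hlim := (((hid.mul hs).const_mul (1 / (Δ : ℝ))).const_add (rhoClosed F)).div_const 2
  have hval : xiClosedDiag F Δ = (rhoClosed F + 1 / (Δ : ℝ) *
      (F * (rhoClosed F / (2 * F) + 1 / (2 * (1 + F))))) / 2 := by
    rw [eq_div_iff two_ne_zero, mul_comm, two_mul_xiClosedDiag hΔ hF]
    field_simp
  rw [hval]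
  refine hlim.congr' ?_
  have hpos : ∀ᶠ t in 𝓝[≠] F, 0 < t := nhdsWithin_le_nhds (lt_mem_nhds hF)
  filter_upwards [hpos, self_mem_nhdsWithin] with t ht hne
  have hne' : F ≠ t := Ne.symm hne
  rw [div_eq_iff two_ne_zero, mul_comm (xiClosed t F Δ), two_mul_xiClosed hΔ ht.le hF.le hne',
    slope_def_field]
  have h1 : F - t ≠ 0 := sub_ne_zero.2 hne'
  have h2 : t - F ≠ 0 := sub_ne_zero.2 hne
  rw [← neg_sub (rhoClosed F), ← neg_sub F t, neg_div_neg_eq]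
  ring

/-! ### The serving station and the SINR conditions. -/

lemma measurable_servingIndex : Measurable servingIndex := by
  have hP : ∀ n, MeasurableSet {x : ℕ → Plane | ∀ m, ‖x n‖ ≤ ‖x m‖} := by
    intro n
    rw [Set.ofPred_forall]
    exact MeasurableSet.iInter fun m => measurableSet_le (by fun_prop) (by fun_prop)
  refine measurable_to_countable' fun k => ?_
  -- The second piece accounts for sequences without a nearest point, where `sInf ∅ = 0`.
  have hset : servingIndex ⁻¹' {k} =
      ({x : ℕ → Plane | ∀ m, ‖x k‖ ≤ ‖x m‖} ∩
        ⋂ j, ⋂ _ : j < k, {x : ℕ → Plane | ∀ m, ‖x j‖ ≤ ‖x m‖}ᶜ) ∪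
      ({_x : ℕ → Plane | k = 0} ∩ ⋂ j, {x : ℕ → Plane | ∀ m, ‖x j‖ ≤ ‖x m‖}ᶜ) := by
    ext x
    simp only [Set.mem_preimage, Set.mem_singleton_iff, Set.mem_union, Set.mem_inter_iff,
      Set.mem_iInter, Set.mem_compl_iff, Set.mem_ofPred_eq, servingIndex]
    constructor
    · rintro rfl
      by_cases hne : {n : ℕ | ∀ m, ‖x n‖ ≤ ‖x m‖}.Nonempty
      · exact Or.inl ⟨Nat.sInf_mem hne, fun j hj => Nat.notMem_of_lt_sInf hj⟩
      · rw [Set.not_nonempty_iff_eq_empty] at hne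
        exact Or.inr ⟨by rw [hne, Nat.sInf_empty], Set.eq_empty_iff_forall_notMem.1 hne⟩
    · rintro (⟨h1, h2⟩ | ⟨rfl, h2⟩)
      · have hmem := Nat.sInf_mem (s := {n : ℕ | ∀ m, ‖x n‖ ≤ ‖x m‖}) ⟨k, h1⟩
        exact le_antisymm (Nat.sInf_le h1) (not_lt.1 fun h => h2 _ h hmem)
      · rw [Set.eq_empty_of_forall_notMem (s := {n : ℕ | ∀ m, ‖x n‖ ≤ ‖x m‖}) h2, Nat.sInf_empty]
  rw [hset]
  exact ((hP k).inter (MeasurableSet.iInter fun j => MeasurableSet.iInter fun _ =>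
    (hP j).compl)).union ((MeasurableSet.const _).inter (MeasurableSet.iInter fun j => (hP j).compl))

lemma servingIndex_spec {x : ℕ → Plane} (h : ∃ n, ∀ m, ‖x n‖ ≤ ‖x m‖) (m : ℕ) :
    ‖x (servingIndex x)‖ ≤ ‖x m‖ :=
  Nat.sInf_mem (s := {n : ℕ | ∀ m, ‖x n‖ ≤ ‖x m‖}) h m

section Sinr

variable {x : ℕ → Plane} {h : ℕ → ℝ} {Z : Set ℕ} {P F : ℝ}

lemma rpow_neg_four (a : ℝ) : a ^ (-4 : ℝ) = (a ^ 4)⁻¹ := by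
  have h4 : (-4 : ℝ) = ((-4 : ℤ) : ℝ) := by norm_num
  rw [h4, Real.rpow_intCast, zpow_neg]
  rfl

lemma ofReal_mul_interference_four (hF : 0 ≤ F) {r : ℝ} :
    ENNReal.ofReal (F * r ^ 4) * interference 4 x h Z =
      ∑' n, Z.indicator (fun n => ENNReal.ofReal (h n * (F * (r / ‖x n‖) ^ 4))) n := by
  rw [interference, ← ENNReal.tsum_mul_left]
  congr 1 with n
  by_cases hn : n ∈ Z
  · rw [Set.indicator_of_mem hn, Set.indicator_of_mem hn, ← ENNReal.ofReal_mul (by positivity),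
      rpow_neg_four, div_pow, div_eq_mul_inv]
    congr 1; ring
  · rw [Set.indicator_of_notMem hn, Set.indicator_of_notMem hn, mul_zero]

lemma ofReal_signal_eq (hP : 0 < P) (hr : 0 < ‖x (servingIndex x)‖) :
    ENNReal.ofReal (P * h (servingIndex x) * ‖x (servingIndex x)‖ ^ (-4 : ℝ)) =
      ENNReal.ofReal (P * (‖x (servingIndex x)‖ ^ 4)⁻¹) * ENNReal.ofReal (h (servingIndex x)) := by
  rw [← ENNReal.ofReal_mul (by positivity), rpow_neg_four]
  congr 1; ring

lemma ofReal_mul_noise_eq (hP : 0 < P) (hF : 0 < F) (hr : 0 < ‖x (servingIndex x)‖) :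
    ENNReal.ofReal F * (ENNReal.ofReal 0 + ENNReal.ofReal P * interference 4 x h Z) =
      ENNReal.ofReal (P * (‖x (servingIndex x)‖ ^ 4)⁻¹) *
        ∑' n, Z.indicator (fun n =>
          ENNReal.ofReal (h n * (F * (‖x (servingIndex x)‖ / ‖x n‖) ^ 4))) n := by
  rw [← ofReal_mul_interference_four hF.le, ENNReal.ofReal_zero, zero_add, ← mul_assoc,
    ← mul_assoc, ← ENNReal.ofReal_mul hF.le, ← ENNReal.ofReal_mul (by positivity)]
  congr 2
  field_simp

/-- Cancels `P r ^ (-4)` from both sides. Positive fading excludes `0 / 0 = 0`, for which the left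
side fails and the right side holds; the strict version needs no such condition. -/
lemma le_sinr_iff (hP : 0 < P) (hF : 0 < F) (hr : 0 < ‖x (servingIndex x)‖)
    (hh : 0 < h (servingIndex x)) :
    ENNReal.ofReal F ≤ sinr P 0 4 x h Z ↔ ∑' n, Z.indicator (fun n =>
      ENNReal.ofReal (h n * (F * (‖x (servingIndex x)‖ / ‖x n‖) ^ 4))) n ≤
        ENNReal.ofReal (h (servingIndex x)) := by
  have hc : 0 < P * (‖x (servingIndex x)‖ ^ 4)⁻¹ := by positivity
  have hs : ENNReal.ofReal (P * h (servingIndex x) * ‖x (servingIndex x)‖ ^ (-4 : ℝ)) ≠ 0 := by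
    rw [rpow_neg_four, ENNReal.ofReal_ne_zero_iff]; positivity
  rw [sinr, ENNReal.le_div_iff_mul_le (Or.inr hs) (Or.inr ENNReal.ofReal_ne_top),
    ofReal_mul_noise_eq hP hF hr, ofReal_signal_eq hP hr,
    ENNReal.mul_le_mul_iff_right (ENNReal.ofReal_ne_zero_iff.2 hc) ENNReal.ofReal_ne_top]

lemma lt_sinr_iff (hP : 0 < P) (hF : 0 < F) (hr : 0 < ‖x (servingIndex x)‖) :
    ENNReal.ofReal F < sinr P 0 4 x h Z ↔ ∑' n, Z.indicator (fun n =>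
      ENNReal.ofReal (h n * (F * (‖x (servingIndex x)‖ / ‖x n‖) ^ 4))) n <
        ENNReal.ofReal (h (servingIndex x)) := by
  have hc : 0 < P * (‖x (servingIndex x)‖ ^ 4)⁻¹ := by positivity
  rw [sinr, ENNReal.lt_div_iff_mul_lt (Or.inr ENNReal.ofReal_ne_top)
    (Or.inr (ENNReal.ofReal_ne_zero_iff.2 hF)), ofReal_mul_noise_eq hP hF hr,
    ofReal_signal_eq hP hr,
    ENNReal.mul_lt_mul_iff_right (ENNReal.ofReal_ne_zero_iff.2 hc) ENNReal.ofReal_ne_top]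

end Sinr

/-- Locations and marks for which the threshold `F` is met on the common sub-band and the threshold
`T` is exceeded on the reserved sub-band. -/
def coverageEvent (Δ : ℕ) (F T : ℝ) : Set ((ℕ → Plane) × (ℕ → ℝ × ℝ × Fin Δ)) :=
  {p | (∑' n, if n = servingIndex p.1 then 0 else ENNReal.ofReal
        ((p.2 n).1 * (F * (‖p.1 (servingIndex p.1)‖ / ‖p.1 n‖) ^ 4))) ≤
      ENNReal.ofReal (p.2 (servingIndex p.1)).1 ∧
    (∑' n, if n = servingIndex p.1 then 0 else
      if (p.2 n).2.2 = (p.2 (servingIndex p.1)).2.2 then ENNReal.ofReal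
        ((p.2 n).2.1 * (T * (‖p.1 (servingIndex p.1)‖ / ‖p.1 n‖) ^ 4)) else 0) <
      ENNReal.ofReal (p.2 (servingIndex p.1)).2.1}

lemma measurableSet_coverageEvent (Δ : ℕ) (F T : ℝ) : MeasurableSet (coverageEvent Δ F T) := by
  -- The serving index takes countably many values, so measurability for each fixed index is enough.
  have hsel : ∀ f : ℕ → (ℕ → Plane) × (ℕ → ℝ × ℝ × Fin Δ) → ℝ≥0∞, (∀ y, Measurable (f y)) →
      Measurable fun p => f (servingIndex p.1) p := by
    intro f hf
    have h1 : Measurable fun q : ℕ × ((ℕ → Plane) × (ℕ → ℝ × ℝ × Fin Δ)) => f q.1 q.2 :=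
      measurable_from_prod_countable_right hf
    exact h1.comp ((measurable_servingIndex.comp measurable_fst).prodMk measurable_id)
  have h1 := hsel (fun y p => ∑' n, if n = y then 0 else ENNReal.ofReal
      ((p.2 n).1 * (F * (‖p.1 y‖ / ‖p.1 n‖) ^ 4))) fun y => Measurable.tsum fun n => by
    by_cases h : n = y
    · simp [h]
    · simp only [h, if_false]
      fun_prop
  have h2 := hsel (fun y p => ENNReal.ofReal (p.2 y).1) fun y => by fun_prop
  have h3 := hsel (fun y p => ∑' n, if n = y then 0 else if (p.2 n).2.2 = (p.2 y).2.2 then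
      ENNReal.ofReal ((p.2 n).2.1 * (T * (‖p.1 y‖ / ‖p.1 n‖) ^ 4)) else 0)
      fun y => Measurable.tsum fun n => by
    by_cases h : n = y
    · simp [h]
    · simp only [h, if_false]
      have hn : Measurable fun p : (ℕ → Plane) × (ℕ → ℝ × ℝ × Fin Δ) => (p.2 n).2.2 := by fun_prop
      have hy : Measurable fun p : (ℕ → Plane) × (ℕ → ℝ × ℝ × Fin Δ) => (p.2 y).2.2 := by fun_prop
      exact Measurable.ite (measurableSet_eq_fun hn hy) (by fun_prop) measurable_const
  have h4 := hsel (fun y p => ENNReal.ofReal (p.2 y).2.1) fun y => by fun_prop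
  exact (measurableSet_le h1 h2).inter (measurableSet_lt h3 h4)

lemma edgeLoss_nonneg {Δ : ℕ} (hΔ : 1 ≤ Δ) {F T : ℝ} (hF : 0 ≤ F) (hT : 0 ≤ T) (u : ℝ) :
    0 ≤ edgeLoss Δ F T u :=
  sub_nonneg.2 (edgeFactor_le_one hΔ (by positivity) (by positivity))

/-- A disc of radius `√(b / (λπ))` has intensity `b`; in the area coordinate the density `λ`
disappears. -/
lemma map_area_Iio {lam : ℝ} (hlam : 0 < lam) (b : ℝ) :
    ((ENNReal.ofReal lam • (volume : Measure Plane)).map fun x => lam * Real.pi * ‖x‖ ^ 2)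
      (Set.Iio b) = ENNReal.ofReal b := by
  have hc : 0 < lam * Real.pi := mul_pos hlam Real.pi_pos
  rw [Measure.map_apply (by fun_prop) measurableSet_Iio, Measure.smul_apply, smul_eq_mul]
  rcases le_or_gt b 0 with hb | hb
  · have : (fun x : Plane => lam * Real.pi * ‖x‖ ^ 2) ⁻¹' Set.Iio b = ∅ := by
      refine Set.eq_empty_of_forall_notMem fun x hx => ?_
      have h1 : lam * Real.pi * ‖x‖ ^ 2 < b := hx
      have h2 : 0 ≤ lam * Real.pi * ‖x‖ ^ 2 := by positivity
      linarith
    rw [this, measure_empty, mul_zero, ENNReal.ofReal_of_nonpos hb]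
  · have : (fun x : Plane => lam * Real.pi * ‖x‖ ^ 2) ⁻¹' Set.Iio b =
        Metric.ball 0 √(b / (lam * Real.pi)) := by
      ext x
      rw [mem_ball_zero_iff, Real.lt_sqrt (norm_nonneg _), lt_div_iff₀ hc, Set.mem_preimage,
        Set.mem_Iio, mul_comm]
    rw [this, EuclideanSpace.volume_ball_fin_two, ← ENNReal.ofReal_pow (Real.sqrt_nonneg _),
      Real.sq_sqrt (by positivity), ← ENNReal.ofReal_mul (by positivity),
      ← ENNReal.ofReal_mul hlam.le]
    congr 1
    field_simp

lemma mem_coverageEvent_iff {Ω : Type*} {Δ : ℕ} {z : ℕ → Ω → Plane} {g g' : ℕ → Ω → ℝ}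
    {δ : ℕ → Ω → Fin Δ} (ω : Ω) (F T : ℝ) :
    ((fun n => z n ω), (fun n => (g n ω, g' n ω, δ n ω))) ∈ coverageEvent Δ F T ↔
      (∑' n, {n | n ≠ servingIndex fun n => z n ω}.indicator (fun n => ENNReal.ofReal
        (g n ω * (F * (‖z (servingIndex fun n => z n ω) ω‖ / ‖z n ω‖) ^ 4))) n ≤
          ENNReal.ofReal (g (servingIndex fun n => z n ω) ω)) ∧
      (∑' n, {n | n ≠ (servingIndex fun n => z n ω) ∧
          δ n ω = δ (servingIndex fun n => z n ω) ω}.indicator (fun n => ENNReal.ofReal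
        (g' n ω * (T * (‖z (servingIndex fun n => z n ω) ω‖ / ‖z n ω‖) ^ 4))) n <
          ENNReal.ofReal (g' (servingIndex fun n => z n ω) ω)) := by
  have h1 : ∀ f : ℕ → ℝ≥0∞, ∀ y : ℕ, ∀ n, {n | n ≠ y}.indicator f n = if n = y then 0 else f n := by
    intro f y n
    by_cases h : n = y <;> simp [h]
  have h2 : ∀ f : ℕ → ℝ≥0∞, ∀ y : ℕ, ∀ n, {n | n ≠ y ∧ δ n ω = δ y ω}.indicator f n =
      if n = y then 0 else if δ n ω = δ y ω then f n else 0 := by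
    intro f y n
    by_cases h : n = y <;> by_cases hd : δ n ω = δ y ω <;> simp [Set.indicator, h, hd]
  simp_rw [h1, h2]
  rfl

/-! ### Probabilities for the network. -/

section Network

variable {Ω : Type*} [MeasurableSpace Ω] {Pr : Measure Ω} {lam μ : ℝ}
  {Δ : ℕ} {z : ℕ → Ω → Plane} {g g' : ℕ → Ω → ℝ} {δ : ℕ → Ω → Fin Δ}

lemma IsStrictFFRNetwork.isPoissonPointProcess_area (hnet : IsStrictFFRNetwork Pr lam μ Δ z g g' δ) :
    IsPoissonPointProcess (fun n ω => lam * Real.pi * ‖z n ω‖ ^ 2)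
      ((ENNReal.ofReal lam • (volume : Measure Plane)).map fun x => lam * Real.pi * ‖x‖ ^ 2) Pr :=
  hnet.poisson.map (f := fun x : Plane => lam * Real.pi * ‖x‖ ^ 2) (by fun_prop)

lemma IsStrictFFRNetwork.ae_norm_pos (hlam : 0 < lam)
    (hnet : IsStrictFFRNetwork Pr lam μ Δ z g g' δ) : ∀ᵐ ω ∂Pr, ∀ n, 0 < ‖z n ω‖ := by
  filter_upwards [hnet.isPoissonPointProcess_area.ae_pos (map_area_Iio hlam)] with ω hω n
  refine norm_pos_iff.2 fun h => ?_
  have := hω n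
  simp [h] at this

/-- Independence of locations and marks allows integrating the marks first. What remains is a
function of area ratios `u`, since the fourth power of the distance ratio is `(u ^ 2)⁻¹`. -/
lemma IsStrictFFRNetwork.measure_coverageEvent [IsProbabilityMeasure Pr] (hlam : 0 < lam) (hμ : 0 < μ) (hΔ : 1 ≤ Δ)
    (hnet : IsStrictFFRNetwork Pr lam μ Δ z g g' δ) {F T : ℝ} (hF : 0 ≤ F) (hT : 0 ≤ T) :
    Pr {ω | ((fun n => z n ω), (fun n => (g n ω, g' n ω, δ n ω))) ∈ coverageEvent Δ F T} =
      ENNReal.ofReal (1 / (1 + ∫ u in Set.Ioi 1, edgeLoss Δ F T u)) := by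
  have hZ : Measurable fun ω n => z n ω := measurable_pi_lambda _ hnet.poisson.measurable
  have hMn : ∀ n, Measurable fun ω => (g n ω, g' n ω, δ n ω) := fun n =>
    (hnet.measurable_g n).prodMk ((hnet.measurable_g' n).prodMk (hnet.measurable_δ n))
  have hM : Measurable fun ω n => (g n ω, g' n ω, δ n ω) := measurable_pi_lambda _ hMn
  have hpZ := Measure.isProbabilityMeasure_map (μ := Pr) hZ.aemeasurable
  have hpM := Measure.isProbabilityMeasure_map (μ := Pr) hM.aemeasurable
  have hS := measurableSet_coverageEvent Δ F T
  have hmap := (indepFun_iff_map_prod_eq_prod_map_map hZ.aemeasurable hM.aemeasurable).1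
    hnet.indep_points_marks
  have hpre : {ω | ((fun n => z n ω), (fun n => (g n ω, g' n ω, δ n ω))) ∈ coverageEvent Δ F T} =
      (fun ω => ((fun n => z n ω), (fun n => (g n ω, g' n ω, δ n ω)))) ⁻¹' coverageEvent Δ F T := rfl
  rw [hpre, ← Measure.map_apply (hZ.prodMk hM) hS, hmap, Measure.prod_apply hS,
    lintegral_map (measurable_measure_prodMk_left hS) hZ]
  have hinner : ∀ x : ℕ → Plane, (Pr.map fun ω n => (g n ω, g' n ω, δ n ω))
      (Prod.mk x ⁻¹' coverageEvent Δ F T) =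
      expNeg (∑' n, if n = servingIndex x then 0 else ENNReal.ofReal (-Real.log (edgeFactor Δ
        (F * (‖x (servingIndex x)‖ / ‖x n‖) ^ 4) (T * (‖x (servingIndex x)‖ / ‖x n‖) ^ 4)))) := by
    intro x
    rw [Measure.map_apply hM (measurable_prodMk_left hS)]
    exact measure_coverage (M := fun n ω => (g n ω, g' n ω, δ n ω)) (inv_pos.2 hμ) hΔ hMn
      hnet.law_marks hnet.indep_marks (servingIndex x)
      (A := fun n => F * (‖x (servingIndex x)‖ / ‖x n‖) ^ 4)
      (B := fun n => T * (‖x (servingIndex x)‖ / ‖x n‖) ^ 4)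
      (fun n => by positivity) (fun n => by positivity)
  simp_rw [hinner]
  have hc : 0 < lam * Real.pi := mul_pos hlam Real.pi_pos
  have hpp := hnet.isPoissonPointProcess_area
  let ψ : ℝ → ℝ≥0∞ := fun u => ENNReal.ofReal (-Real.log (edgeFactor Δ
    (F * (u ^ 2)⁻¹) (T * (u ^ 2)⁻¹)))
  have hψ : AntitoneOn ψ (Set.Ioi 0) := by
    intro u hu v hv huv
    have hu' : 0 < u := hu
    have hinv : (v ^ 2)⁻¹ ≤ (u ^ 2)⁻¹ := by gcongr
    refine ENNReal.ofReal_le_ofReal (neg_le_neg (Real.log_le_log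
      (edgeFactor_pos hΔ (by positivity) (by positivity)) (edgeFactor_anti hΔ (by positivity)
      (by positivity) (mul_le_mul_of_nonneg_left hinv hF) (mul_le_mul_of_nonneg_left hinv hT))))
  have hy : ∀ᵐ ω ∂Pr, ∀ m, lam * Real.pi * ‖z (servingIndex fun n => z n ω) ω‖ ^ 2 ≤
      lam * Real.pi * ‖z m ω‖ ^ 2 := by
    filter_upwards [hpp.ae_exists_forall_le (map_area_Iio hlam)] with ω ⟨n, hn⟩ m
    have hspec := servingIndex_spec (x := fun n => z n ω) ⟨n, fun m => le_of_sq_le_sq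
      (le_of_mul_le_mul_left (hn m) hc) (norm_nonneg _)⟩ m
    gcongr
  have hratio := hpp.lintegral_expNeg_ratio (map_area_Iio hlam) hψ hy
  have hterm : ∀ ω n, ψ (lam * Real.pi * ‖z n ω‖ ^ 2 /
      (lam * Real.pi * ‖z (servingIndex fun n => z n ω) ω‖ ^ 2)) =
      ENNReal.ofReal (-Real.log (edgeFactor Δ
        (F * (‖z (servingIndex fun n => z n ω) ω‖ / ‖z n ω‖) ^ 4)
        (T * (‖z (servingIndex fun n => z n ω) ω‖ / ‖z n ω‖) ^ 4))) := by
    intro ω n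
    have e : ((lam * Real.pi * ‖z n ω‖ ^ 2 /
      (lam * Real.pi * ‖z (servingIndex fun n => z n ω) ω‖ ^ 2)) ^ 2)⁻¹ =
      (‖z (servingIndex fun n => z n ω) ω‖ / ‖z n ω‖) ^ 4 := by
      rw [mul_div_mul_left _ _ hc.ne', ← div_pow, ← pow_mul, ← inv_pow, inv_div]
    simp only [ψ, e]
  simp_rw [hterm] at hratio
  rw [hratio]
  have hloss : ∀ u, 1 - expNeg (ψ u) = ENNReal.ofReal (edgeLoss Δ F T u) := by
    intro u
    have hF' : 0 ≤ F * (u ^ 2)⁻¹ := by positivity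
    have hT' : 0 ≤ T * (u ^ 2)⁻¹ := by positivity
    rw [expNeg_ofReal_neg_log (edgeFactor_pos hΔ hF' hT') (edgeFactor_le_one hΔ hF' hT'), edgeLoss,
      ENNReal.ofReal_sub _ (edgeFactor_pos hΔ hF' hT').le, ENNReal.ofReal_one]
  have hint : 0 ≤ ∫ u in Set.Ioi 1, edgeLoss Δ F T u :=
    integral_nonneg fun u => edgeLoss_nonneg hΔ hF hT u
  simp_rw [hloss]
  rw [setLIntegral_congr (Ioi_ae_eq_Ici (a := (1 : ℝ))).symm, ← ofReal_integral_eq_lintegral_ofReal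
    (integrableOn_edgeLoss Δ hF hT) (ae_of_all _ fun u => edgeLoss_nonneg hΔ hF hT u),
    ← ENNReal.ofReal_one, ← ENNReal.ofReal_add zero_le_one hint,
    ← ENNReal.ofReal_inv_of_pos (by positivity), one_div]

lemma ae_expMeasure_pos {r : ℝ} (hr : 0 < r) : ∀ᵐ x ∂(expMeasure r), 0 < x := by
  have := isProbabilityMeasure_expMeasure hr
  have h := expMeasure_ofReal_gt hr 0
  rw [mul_zero, expNeg_zero] at h
  filter_upwards [(mem_ae_iff_prob_eq_one
    (measurableSet_lt measurable_const ENNReal.measurable_ofReal)).2 h] with x hx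
  exact ENNReal.ofReal_pos.1 hx

lemma IsStrictFFRNetwork.ae_fading_pos (hμ : 0 < μ)
    (hnet : IsStrictFFRNetwork Pr lam μ Δ z g g' δ) :
    ∀ᵐ ω ∂Pr, ∀ n, 0 < g n ω ∧ 0 < g' n ω := by
  have hr := inv_pos.2 hμ
  have := isProbabilityMeasure_expMeasure hr
  refine ae_all_iff.2 fun n => ?_
  have h1 : ∀ᵐ m ∂((expMeasure μ⁻¹).prod ((expMeasure μ⁻¹).prod
      (uniformOn (Set.univ : Set (Fin Δ))))), 0 < m.1 ∧ 0 < m.2.1 :=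
    (Measure.quasiMeasurePreserving_fst.ae (ae_expMeasure_pos hr)).and
      (Measure.quasiMeasurePreserving_snd.ae
        (Measure.quasiMeasurePreserving_fst.ae (ae_expMeasure_pos hr)))
  rw [← (hnet.law_marks n).map_eq] at h1
  exact ae_of_ae_map (hnet.law_marks n).aemeasurable h1

/-- Setting `T = 0` leaves the reserved condition `0 < g'`, almost surely true, and `F = 0` leaves
`0 ≤ g`, trivial in `[0, ∞]`. The marginal events are thus instances of the joint one. -/
lemma IsStrictFFRNetwork.ae_sinr_iff {P F T : ℝ} (hlam : 0 < lam) (hμ : 0 < μ) (hP : 0 < P)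
    (hF : 0 < F) (hT : 0 < T) (hnet : IsStrictFFRNetwork Pr lam μ Δ z g g' δ) :
    ∀ᵐ ω ∂Pr,
      (ENNReal.ofReal F ≤ commonSinr P 0 4 (fun n => z n ω) (fun n => g n ω) ↔
        ((fun n => z n ω), (fun n => (g n ω, g' n ω, δ n ω))) ∈ coverageEvent Δ F 0) ∧
      (ENNReal.ofReal T < edgeSinr P 0 4 (fun n => z n ω) (fun n => g' n ω) (fun n => δ n ω) ↔
        ((fun n => z n ω), (fun n => (g n ω, g' n ω, δ n ω))) ∈ coverageEvent Δ 0 T) ∧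
      (((fun n => z n ω), (fun n => (g n ω, g' n ω, δ n ω))) ∈ coverageEvent Δ F T ↔
        ENNReal.ofReal F ≤ commonSinr P 0 4 (fun n => z n ω) (fun n => g n ω) ∧
        ENNReal.ofReal T <
          edgeSinr P 0 4 (fun n => z n ω) (fun n => g' n ω) (fun n => δ n ω)) := by
  filter_upwards [hnet.ae_norm_pos hlam, hnet.ae_fading_pos hμ] with ω hz hg
  have hC := le_sinr_iff (x := fun n => z n ω) (h := fun n => g n ω)
    (Z := {n | n ≠ servingIndex fun n => z n ω}) hP hF (hz _) (hg _).1
  have hD := lt_sinr_iff (x := fun n => z n ω) (h := fun n => g' n ω)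
    (Z := {n | n ≠ (servingIndex fun n => z n ω) ∧ δ n ω = δ (servingIndex fun n => z n ω) ω})
    hP hT (hz _)
  simp_rw [mem_coverageEvent_iff]
  rw [commonSinr, edgeSinr, hC, hD]
  have hpos := (hg (servingIndex fun n => z n ω)).2
  simp [hpos]

end Network

theorem mainTheorem7 {Ω : Type*} [MeasurableSpace Ω] (Pr : Measure Ω) [IsProbabilityMeasure Pr]
    (lam μ P T TFR : ℝ) (Δ : ℕ) (hlam : 0 < lam) (hμ : 0 < μ) (hP : 0 < P)
    (hT : 0 < T) (hTFR : 0 < TFR) (hΔ : 1 ≤ Δ)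
    (z : ℕ → Ω → Plane) (g g' : ℕ → Ω → ℝ) (δ : ℕ → Ω → Fin Δ)
    (hnet : IsStrictFFRNetwork Pr lam μ Δ z g g' δ) :
    strictFFREdgeCoverage Pr z g g' δ P 0 4 TFR T =
        (1 + rhoFFR TFR 4) / rhoFFR TFR 4 *
          (1 / (1 + rhoFFR T 4 / Δ) - 1 / (1 + 2 * xiFFR T TFR 4 Δ)) ∧
      (T ≠ TFR → xiFFR T TFR 4 Δ = xiClosed T TFR Δ) ∧
      (T = TFR → xiFFR T TFR 4 Δ = xiClosedDiag TFR Δ) ∧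
      Tendsto (fun t => xiClosed t TFR Δ) (𝓝[≠] TFR) (𝓝 (xiClosedDiag TFR Δ)) := by
  refine ⟨?_, fun h => ?_, ?_, tendsto_xiClosed hΔ hTFR⟩
  · set C := {ω | commonSinr P 0 4 (fun n => z n ω) (fun n => g n ω) < ENNReal.ofReal TFR}
    set D := {ω | ENNReal.ofReal T <
      edgeSinr P 0 4 (fun n => z n ω) (fun n => g' n ω) (fun n => δ n ω)}
    let E : ℝ → ℝ → Set Ω := fun F T =>
      {ω | ((fun n => z n ω), (fun n => (g n ω, g' n ω, δ n ω))) ∈ coverageEvent Δ F T}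
    have hE : ∀ F T, MeasurableSet (E F T) := fun F T =>
      ((measurable_pi_lambda _ hnet.poisson.measurable).prodMk (measurable_pi_lambda _ fun n =>
        (hnet.measurable_g n).prodMk ((hnet.measurable_g' n).prodMk (hnet.measurable_δ n))))
        (measurableSet_coverageEvent Δ F T)
    have hae := hnet.ae_sinr_iff hlam hμ hP hTFR hT
    have hCc : (Cᶜ : Set Ω) =ᵐ[Pr] E TFR 0 := by
      filter_upwards [hae] with ω hω
      exact propext (not_lt.trans hω.1)
    have hDE : D =ᵐ[Pr] E 0 T := by
      filter_upwards [hae] with ω hω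
      exact propext hω.2.1
    have hDC : (D \ C : Set Ω) =ᵐ[Pr] E TFR T := by
      filter_upwards [hae] with ω hω
      refine propext (Iff.trans ?_ hω.2.2.symm)
      exact ⟨fun h => ⟨not_lt.1 h.2, h.1⟩, fun h => ⟨h.2, not_lt.2 h.1⟩⟩
    -- Almost sure equality with a measurable event is all that is known about `C`, and it suffices
    -- for conditioning.
    have hCnull : NullMeasurableSet C Pr := by
      rw [← compl_compl C]
      exact ((hE TFR 0).nullMeasurableSet.congr hCc.symm).compl
    have hloss : ∀ F T : ℝ, 0 ≤ F → 0 ≤ T →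
        (Pr (E F T)).toReal = 1 / (1 + ∫ u in Set.Ioi 1, edgeLoss Δ F T u) := by
      intro F T hF hT
      have hint : 0 ≤ ∫ u in Set.Ioi 1, edgeLoss Δ F T u :=
        integral_nonneg fun u => edgeLoss_nonneg hΔ hF hT u
      rw [show Pr (E F T) = _ from hnet.measure_coverageEvent hlam hμ hΔ hF hT,
        ENNReal.toReal_ofReal (by positivity)]
    have hPC : (Pr C).toReal = 1 - 1 / (1 + rhoFFR TFR 4) := by
      have h1 : (Pr Cᶜ).toReal = 1 / (1 + rhoFFR TFR 4) := by
        rw [measure_congr hCc, hloss TFR 0 hTFR.le le_rfl,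
          integral_edgeLoss_of_ne Δ hTFR.le le_rfl hTFR.ne', rhoFFR_four hTFR]
        simp
      have h2 := congrArg ENNReal.toReal (measure_add_measure_compl₀ hCnull)
      rw [measure_univ, ENNReal.toReal_add (measure_ne_top _ _) (measure_ne_top _ _), ENNReal.toReal_one] at h2
      linarith
    -- Computed as `P(D) - P(D \ C)`, because tails of the common fading are exponential only for
    -- the complement of `C`.
    have hPDC : (Pr (D ∩ C)).toReal =
        1 / (1 + rhoFFR T 4 / Δ) - 1 / (1 + 2 * xiFFR T TFR 4 Δ) := by
      have h1 : (Pr D).toReal = 1 / (1 + rhoFFR T 4 / Δ) := by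
        rw [measure_congr hDE, hloss 0 T le_rfl hT.le,
          integral_edgeLoss_of_ne Δ le_rfl hT.le hT.ne, rhoFFR_four hT, rhoClosed_zero]
        congr 2
        have hT0 := hT.ne'
        field_simp
        ring
      have h2 : (Pr (D \ C)).toReal = 1 / (1 + 2 * xiFFR T TFR 4 Δ) := by
        rw [measure_congr hDC, hloss TFR T hTFR.le hT.le, two_mul_xiFFR_four]
      have h3 := congrArg ENNReal.toReal (measure_inter_add_sdiff₀ D hCnull)
      rw [ENNReal.toReal_add (measure_ne_top _ _) (measure_ne_top _ _)] at h3
      linarith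
    have hρ : 0 < rhoFFR TFR 4 := by
      rw [rhoFFR_four hTFR, rhoClosed]
      exact mul_pos (Real.sqrt_pos.2 hTFR) (sub_pos.2 (Real.arctan_lt_pi_div_two _))
    rw [strictFFREdgeCoverage, ProbabilityTheory.cond, Measure.smul_apply, smul_eq_mul,
      Measure.restrict_apply₀' hCnull, ENNReal.toReal_mul, ENNReal.toReal_inv, hPC, hPDC]
    congr 1
    have hρ1 : 1 + rhoFFR TFR 4 ≠ 0 := by positivity
    rw [one_sub_div hρ1, add_sub_cancel_left, inv_div]
  · have h2 := two_mul_xiClosed hΔ hT.le hTFR.le h.symm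
    rw [← integral_edgeLoss_of_ne Δ hTFR.le hT.le h.symm, ← two_mul_xiFFR_four] at h2
    linarith
  · rintro rfl
    have h2 := two_mul_xiClosedDiag hΔ hT
    rw [← integral_edgeLoss_self Δ hT, ← two_mul_xiFFR_four] at h2
    linarith
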